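/- **Setting.** For every $n\ge 2$ let $p_n$ be a dimension, $\mathcal P_n$ a Borel probability measure on $\mathbb R\times\mathbb R^{p_n}$, and let $(y_i,x_i)$, $1\le i\le n+1$, be i.i.d. pairs with distribution $\mathcal P_n$ (all quantities may depend on $n$). The training data are $T_n=(y_i,x_i)_{i=1}^n$. For all $p,m$ let $\mathcal A_{p,m}:\mathbb R^p\times(\mathbb R\times\mathbb R^{p})^m\to\mathbb R$ be Borel measurable. Let $\mathcal K_n=(K_1,\dots,K_{k_n})$ be a partition of $\{1,\dots,n\}$ into $k_n\ge 2$ nonempty folds. Write $\hat y_{n+1}=\mathcal A_{p_n,n}(x_{n+1},T_n)$ and, for $1\le i\le n+1$, $\hat y_i^{\setminus K_j}=\mathcal A_{p_n,n-|K_j|}(x_i,T_n^{\setminus K_j})$, where $T_n^{\setminus K_j}$ is $T_n$ without the observations with index in $K_j$ (in their original order). For $i\in K_j$ put $\hat u_i=y_i-\hat y_i^{\setminus K_j}$, $v_i=\hat y_{n+1}+\hat u_i$ and $v_i^+=\hat y_{n+1}^{\setminus K_j}+\hat u_i$, and let $$G(t)=\frac1{k_n}\sum_{j=1}^{k_n}\frac1{|K_j|}\sum_{i\in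 K_j}\mathbf 1\{v_i\le t\},\qquad G^+(t)=\frac1{k_n}\sum_{j=1}^{k_n}\frac1{|K_j|}\sum_{i\in K_j}\mathbf 1\{v^+_i\le t\}.$$ For a distribution function $F$ let $Q_\alpha(F)=\inf\{x\in\mathbb R:F(x)\ge\alpha\}\in[-\infty,\infty]$ (with $\inf\emptyset=+\infty$). For $\delta\in\mathbb R$ and $0\le\alpha_1\le\alpha_2\le1$ the $\delta$-distorted CV and CV+ prediction intervals are $$PI_{\alpha_1,\alpha_2}(\delta)=[Q_{\alpha_1}(G)-\delta,\;Q_{\alpha_2}(G)+\delta],\qquad PI^+_{\alpha_1,\alpha_2}(\delta)=[Q_{\alpha_1}(G^+)-\delta,\;Q_{\alpha_2}(G^+)+\delta],$$ where $[a,b]=\emptyset$ if $a>b$. Conditional probabilities given $T_n$ are computed from a regular conditional distribution of $(y_{n+1},x_{n+1})$ given $T_n$. A sequence of random variables $X_n$ ($n\ge2$) is stochastically bounded if for every $\epsilon>0$ there is $M<\infty$ with $\mathbb P(|X_n|>M)\le\epsilon$ for all $n\ge 2$. *Assumption (CC):* for every $n\ge2$ and almost every $x$ with respect to the distribution of $x_1$,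 the conditional distribution of $y_1$ given $x_1=x$ is absolutely continuous with a density $f_{y_1|x_1=x}$ of finite supremum norm $\|f_{y_1|x_1=x}\|_\infty$; and the sequence of random variables $\|f_{y_1|x_1}\|_\infty$ is stochastically bounded. (The norm is the essential supremum, that is, the least supremum among all versions of the density.) **Theorem.** Suppose that the predictor is stable with respect to $(\mathcal K_n)$, that is, $$\lim_{n\to\infty}\frac1{k_n}\sum_{j=1}^{k_n}\mathbb P\big(|\hat y_{n+1}-\hat y_{n+1}^{\setminus K_j}|\ge\epsilon\big)=0\quad\text{for all }\epsilon>0.$$ a) (*Asymptotic equivalence of CV and CV+.*) (i) The following two statements are equivalent: - for all $\delta>0$ and $\epsilon>0$, $\ \lim_{n\to\infty}\mathbb P\big(\inf_{0\le\alpha_1\le\alpha_2\le1}[\mathbb P(y_{n+1}\in PI_{\alpha_1,\alpha_2}(\delta)\mid T_n)-(\alpha_2-\alpha_1)]\ge-\epsilon\big)=1$; - for all $\delta>0$ and $\epsilon>0$, $\ \lim_{n\to\infty}\mathbb P\big(\inf_{0\le\alpha_1\le\alpha_2\le1}[\mathbb P(y_{n+1}\in PI^+_{\alpha_1,\alpha_2}(\delta)\mid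 T_n)-(\alpha_2-\alpha_1)]\ge-\epsilon\big)=1$. (ii) If, in addition, (CC) holds, the following two statements are equivalent: - $\lim_{n\to\infty}\mathbb E\big(\sup_{0\le\alpha_1\le\alpha_2\le1}|\mathbb P(y_{n+1}\in PI_{\alpha_1,\alpha_2}(0)\mid T_n)-(\alpha_2-\alpha_1)|\big)=0$; - $\lim_{n\to\infty}\mathbb E\big(\sup_{0\le\alpha_1\le\alpha_2\le1}|\mathbb P(y_{n+1}\in PI^+_{\alpha_1,\alpha_2}(0)\mid T_n)-(\alpha_2-\alpha_1)|\big)=0$. b) (*Asymptotic validity of $k_n$-fold CV.*) Suppose, in addition, that the prediction error $y_{n+1}-\hat y_{n+1}$ is stochastically bounded and that $k_n\to\infty$. (i) For all $\delta>0$ and $\epsilon>0$, $$\lim_{n\to\infty}\mathbb P\Big(\inf_{0\le\alpha_1\le\alpha_2\le1}\big[\mathbb P(y_{n+1}\in PI_{\alpha_1,\alpha_2}(\delta)\mid T_n)-(\alpha_2-\alpha_1)\big]\ge-\epsilon\Big)=1,$$ $$\lim_{n\to\infty}\mathbb P\Big(\sup_{0\le\alpha_1\le\alpha_2\le1}\big[\mathbb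 P(y_{n+1}\in PI_{\alpha_1,\alpha_2}(-\delta)\mid T_n)-(\alpha_2-\alpha_1)\big]\le\epsilon\Big)=1.$$ (ii) If (CC) also holds, then $$\lim_{n\to\infty}\mathbb E\Big(\sup_{0\le\alpha_1\le\alpha_2\le1}\big|\mathbb P(y_{n+1}\in PI_{\alpha_1,\alpha_2}(0)\mid T_n)-(\alpha_2-\alpha_1)\big|\Big)=0.$$ -/

import Mathlib

open MeasureTheory ProbabilityTheory Filter Topology
open scoped ENNReal NNReal

namespace CrossVal

noncomputable section

/-- A response-feature pair `(y, x)` with `y ∈ ℝ` and `x ∈ ℝ^p`. -/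
abbrev Obs (p : ℕ) : Type := ℝ × (Fin p → ℝ)

/-- A prediction algorithm: for all `p` and `m` a function of a new feature vector in `ℝ^p` and of
`m` training pairs. (Borel measurability is a hypothesis of the theorem.) -/
abbrev Algorithm : Type := (p m : ℕ) → (Fin p → ℝ) × (Fin m → Obs p) → ℝ

/-- `Z 0, …, Z (n-1)` (training pairs) and `Z n` (new pair) are i.i.d. with law `P`. -/
structure IsIIDSample {Ω : Type*} [MeasurableSpace Ω] (μ : Measure Ω) {p n : ℕ}
    (P : Measure (Obs p)) (Z : Fin (n + 1) → Ω → Obs p) : Prop where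
  measurable : ∀ i, Measurable (Z i)
  indep : iIndepFun Z μ
  law : ∀ i, μ.map (Z i) = P

/-- The training data `T_n`, that is, the first `n` of the `n + 1` pairs. -/
def trainingData {Ω : Type*} {p n : ℕ} (Z : Fin (n + 1) → Ω → Obs p) (ω : Ω) : Fin n → Obs p :=
  fun i => Z i.castSucc ω

/-- The new pair `(y_{n+1}, x_{n+1})`. -/
def newObs {Ω : Type*} {p n : ℕ} (Z : Fin (n + 1) → Ω → Obs p) (ω : Ω) : Obs p :=
  Z (Fin.last n) ω

/-- `K_1, …, K_k` are nonempty, pairwise disjoint and cover the index set of the training data. -/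
structure IsFoldPartition {n k : ℕ} (K : Fin k → Finset (Fin n)) : Prop where
  nonempty : ∀ j, (K j).Nonempty
  disjoint : ∀ i j, i ≠ j → Disjoint (K i) (K j)
  cover : ∀ i, ∃ j, i ∈ K j

/-- The training data without the observations in the fold `K`, in their original order. -/
def leaveOut {p n : ℕ} (T : Fin n → Obs p) (K : Finset (Fin n)) : Fin Kᶜ.card → Obs p :=
  fun i => T (Kᶜ.orderEmbOfFin rfl i)

/-- The prediction at `x` based on the full training data `T`. -/
def predict (A : Algorithm) {p n : ℕ} (T : Fin n → Obs p) (x : Fin p → ℝ) : ℝ :=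
  A p n (x, T)

/-- The prediction at `x` based on the training data without the fold `K`. -/
def predictWithout (A : Algorithm) {p n : ℕ} (T : Fin n → Obs p) (K : Finset (Fin n))
    (x : Fin p → ℝ) : ℝ :=
  A p Kᶜ.card (x, leaveOut T K)

/-- The leave-one-fold-out error of observation `i`, where `K` is the fold that contains `i`. -/
def cvError (A : Algorithm) {p n : ℕ} (T : Fin n → Obs p) (K : Finset (Fin n)) (i : Fin n) : ℝ :=
  (T i).1 - predictWithout A T K (T i).2

/-- The distribution function that puts mass `1 / (k |K_j|)` on `v j i` for each `i ∈ K_j`. -/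
def foldCdf {n k : ℕ} (K : Fin k → Finset (Fin n)) (v : Fin k → Fin n → ℝ) (t : ℝ) : ℝ :=
  (1 / (k : ℝ)) * ∑ j, (1 / ((K j).card : ℝ)) * ∑ i ∈ K j, (if v j i ≤ t then 1 else 0)

/-- `G^{CV}`, the weighted empirical distribution function of the values
`v_i = ŷ_{n+1} + û_i`. -/
def cvCdf (A : Algorithm) {p n k : ℕ} (K : Fin k → Finset (Fin n)) (T : Fin n → Obs p)
    (x : Fin p → ℝ) : ℝ → ℝ :=
  foldCdf K fun j i => predict A T x + cvError A T (K j) i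

/-- `G^{CV+}`, the same with `ŷ_{n+1}` replaced by the prediction without the fold of `i`. -/
def cvPlusCdf (A : Algorithm) {p n k : ℕ} (K : Fin k → Finset (Fin n)) (T : Fin n → Obs p)
    (x : Fin p → ℝ) : ℝ → ℝ :=
  foldCdf K fun j i => predictWithout A T (K j) x + cvError A T (K j) i

/-- The `α`-quantile `inf {x ∈ ℝ : F x ≥ α} ∈ [-∞, ∞]`, with `inf ∅ = ∞`. -/
def quantile (α : ℝ) (F : ℝ → ℝ) : EReal :=
  sInf ((fun x : ℝ => (x : EReal)) '' {x : ℝ | α ≤ F x})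

/-- The real points of `[Q_{α₁}(G) - δ, Q_{α₂}(G) + δ]` for `α = (α₁, α₂)`. -/
def distortedInterval (G : ℝ → ℝ) (α : ℝ × ℝ) (δ : ℝ) : Set ℝ :=
  {y : ℝ | quantile α.1 G - (δ : EReal) ≤ (y : EReal) ∧
    (y : EReal) ≤ quantile α.2 G + (δ : EReal)}

/-- The `δ`-distorted CV prediction interval for `y_{n+1}`. -/
def cvInterval (A : Algorithm) {p n k : ℕ} (K : Fin k → Finset (Fin n)) (δ : ℝ) (α : ℝ × ℝ)
    (T : Fin n → Obs p) (x : Fin p → ℝ) : Set ℝ :=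
  distortedInterval (cvCdf A K T x) α δ

/-- The `δ`-distorted CV+ prediction interval for `y_{n+1}`. -/
def cvPlusInterval (A : Algorithm) {p n k : ℕ} (K : Fin k → Finset (Fin n)) (δ : ℝ) (α : ℝ × ℝ)
    (T : Fin n → Obs p) (x : Fin p → ℝ) : Set ℝ :=
  distortedInterval (cvPlusCdf A K T x) α δ

/-- The set of all `(α₁, α₂)` with `0 ≤ α₁ ≤ α₂ ≤ 1`. -/
def levels : Set (ℝ × ℝ) := {α | 0 ≤ α.1 ∧ α.1 ≤ α.2 ∧ α.2 ≤ 1}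

/-- `P(y_{n+1} ∈ PI | T_n) (ω)`, for a prediction set `PI` that is a function of the training data
and of `x_{n+1}`, computed from the regular conditional distribution of the new pair given the
training data, so that infima and suprema over uncountably many prediction sets make sense. -/
def condCoverage {Ω : Type*} [MeasurableSpace Ω] (μ : Measure Ω) [IsFiniteMeasure μ] {p n : ℕ}
    (Z : Fin (n + 1) → Ω → Obs p) (PI : (Fin n → Obs p) → (Fin p → ℝ) → Set ℝ) (ω : Ω) : ℝ :=
  (condDistrib (newObs Z) (trainingData Z) μ (trainingData Z ω)).real
    {z | z.1 ∈ PI (trainingData Z ω) z.2}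

section Asymptotics

variable {Ω : ℕ → Type*} [∀ n, MeasurableSpace (Ω n)] (μ : ∀ n, Measure (Ω n))

/-- Stochastic boundedness of a sequence (indexed by `n ≥ 2`) of random variables with values
in `[0, ∞]`. -/
def IsStochBounded (X : ∀ n, Ω n → ℝ≥0∞) : Prop :=
  ∀ ε : ℝ, 0 < ε → ∃ M : ℝ≥0, ∀ n, 2 ≤ n → (μ n).real {ω | (M : ℝ≥0∞) < X n ω} ≤ ε

variable {p : ℕ → ℕ} (Z : ∀ n, Fin (n + 1) → Ω n → Obs (p n))

/-- The prediction error `y_{n+1} - ŷ_{n+1}` is stochastically bounded. -/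
def HasBoundedPredictionError (A : Algorithm) : Prop :=
  IsStochBounded μ fun n ω =>
    ‖(newObs (Z n) ω).1 - predict A (trainingData (Z n) ω) (newObs (Z n) ω).2‖ₑ

/-- Asymptotic out-of-sample stability with respect to the sequence of partitions `K`. -/
def IsStable (A : Algorithm) {k : ℕ → ℕ} (K : ∀ n, Fin (k n) → Finset (Fin n)) : Prop :=
  ∀ ε : ℝ, 0 < ε → Tendsto (fun n => (1 / (k n : ℝ)) * ∑ j, (μ n).real
    {ω | ε ≤ |predict A (trainingData (Z n) ω) (newObs (Z n) ω).2 -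
      predictWithout A (trainingData (Z n) ω) (K n j) (newObs (Z n) ω).2|}) atTop (𝓝 0)

variable [∀ n, IsFiniteMeasure (μ n)]
  (PI : ∀ n, ℝ × ℝ → (Fin n → Obs (p n)) → (Fin (p n) → ℝ) → Set ℝ)

/-- Asymptotically uniformly conditionally conservative prediction sets. -/
def IsUnifConservative : Prop :=
  ∀ ε : ℝ, 0 < ε → Tendsto (fun n => (μ n).real
    {ω | -ε ≤ (⨅ α : levels, (condCoverage (μ n) (Z n) (PI n α) ω - (α.1.2 - α.1.1)))})
    atTop (𝓝 1)

/-- The conditional coverage probability uniformly does not overshoot its nominal level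
asymptotically. -/
def IsUnifNotOvershooting : Prop :=
  ∀ ε : ℝ, 0 < ε → Tendsto (fun n => (μ n).real
    {ω | (⨆ α : levels, (condCoverage (μ n) (Z n) (PI n α) ω - (α.1.2 - α.1.1))) ≤ ε})
    atTop (𝓝 1)

/-- Asymptotically uniformly conditionally valid prediction sets. -/
def IsUnifValid : Prop :=
  Tendsto (fun n => ∫ ω, (⨆ α : levels,
    |condCoverage (μ n) (Z n) (PI n α) ω - (α.1.2 - α.1.1)|) ∂(μ n)) atTop (𝓝 0)

end Asymptotics

/-- The conditional distribution of `y` given `x`, for `(y, x)` distributed according to `P`. -/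
def condLaw {p : ℕ} (P : Measure (Obs p)) [IsFiniteMeasure P] : Kernel (Fin p → ℝ) ℝ :=
  condDistrib Prod.fst Prod.snd P

/-- The supremum norm of the Lebesgue density of `y` given `x`. A density is determined only up
to null sets: the essential supremum is the least supremum over all versions, and is attained. -/
def densitySup {p : ℕ} (P : Measure (Obs p)) [IsFiniteMeasure P] (x : Fin p → ℝ) : ℝ≥0∞ :=
  essSup ((condLaw P x).rnDeriv volume) volume

/-- The Continuous Case Assumption. -/
structure ContinuousCase {p : ℕ → ℕ} (P : ∀ n, Measure (Obs (p n))) [∀ n, IsFiniteMeasure (P n)] :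
    Prop where
  bounded_density : ∀ n, 2 ≤ n → ∀ᵐ x ∂((P n).map Prod.snd),
    condLaw (P n) x ≪ volume ∧ densitySup (P n) x < ∞
  stoch_bounded : IsStochBounded (fun n => (P n).map Prod.snd) fun n => densitySup (P n)

end

end CrossVal

/-!
The new pair is independent of the training data `T`, so outside one null set the conditional
coverage of every prediction set is its probability under the law `P` of a pair, with `T` frozen
(`IsIIDSample.ae_condCoverage_eq`). A point `y` lies in the interval with levels `(α₁, α₂)` and
distortion `δ` exactly if `α₁ ≤ G (y + δ)` and `G⁻ (y - δ) < α₂`, where `G⁻` is the left limit of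
`G` (`mem_distortedInterval_iff`). Everything thus reduces to comparing distribution functions.

*CV versus CV+.* The values of the two methods differ on the fold `j` by the change of the
prediction when this fold is left out. If that change is at least `η` on at most a proportion `ε` of
the folds, the two distribution functions are within `η` horizontally and `ε` vertically
(`foldCdf_le_of_close`, `foldCdfLT_le_of_close`), and stability makes the exceptional event
improbable. The vertical error is absorbed by moving the levels by `ε`, the horizontal one by
enlarging `δ` (`neg_le_coverage_sub_of_close`). In the continuous case `δ` need not be enlarged: the
points that change sides when an interval is moved by `η` form a set with thin sections, which is
uniformly improbable (`measureReal_le_of_sections_thin`). As shifted levels may leave `[0, 1]`, the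
comparison is made for one-sided intervals (`maxCoverageError_le_of_close`). The expectation of the
supremum over all levels is meaningful because, by monotonicity, rational levels suffice
(`maxCoverageError_eq_iSup_rat`).

*Validity of CV.* Here both sides can be expressed in terms of the new prediction error, and the
claim is that the distribution function of the leave-one-fold-out errors is close to the conditional
distribution function of the prediction error. For a Lipschitz function `h` with values in `[0, 1]`
let `W j` be the average of `h` over the errors of the fold `j`, minus its mean for a new
observation, given the prediction without fold `j`. Resampling the fold `j` makes `W j` centred. It
hardly changes `W l` for `l ≠ j`: at a new observation the prediction without fold `l` is close to
the full prediction, hence to the prediction without fold `j`, which does not notice the resampling;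
and the observations in fold `l` are new for the prediction without that fold. So the `W j` are
nearly uncorrelated (`integral_foldDeviation_mul_le`), and their average is small in mean square
when the number of folds is large (`integral_sq_avg_foldDeviation_le`). Finitely many ramp functions
`h` and tightness of the prediction error bound the Lévy distance of the two distributions
(`levy_of_ramps`), and the probability integral transform, as an inequality
(`measureReal_cdf_between_le`), turns this into bounds for the coverage that are uniform in the
levels.
-/

namespace CrossVal

/-! ### Weighted averages over folds -/

section FoldAverages

variable {n k : ℕ} {K : Fin k → Finset (Fin n)}

/-- The average of `g` in which each fold has weight `1 / k`, shared equally among its members. -/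
noncomputable def foldAvg (K : Fin k → Finset (Fin n)) (g : Fin k → Fin n → ℝ) : ℝ :=
  (1 / (k : ℝ)) * ∑ j, (1 / ((K j).card : ℝ)) * ∑ i ∈ K j, g j i

/-- The left limit of `foldCdf K v`: the mass strictly below `t`. -/
noncomputable def foldCdfLT (K : Fin k → Finset (Fin n)) (v : Fin k → Fin n → ℝ) (t : ℝ) : ℝ :=
  foldAvg K fun j i => if v j i < t then 1 else 0

lemma foldCdf_eq_foldAvg (K : Fin k → Finset (Fin n)) (v : Fin k → Fin n → ℝ) (t : ℝ) :
    foldCdf K v t = foldAvg K fun j i => if v j i ≤ t then 1 else 0 := rfl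

lemma foldAvg_mono {g h : Fin k → Fin n → ℝ} (hgh : ∀ j, ∀ i ∈ K j, g j i ≤ h j i) :
    foldAvg K g ≤ foldAvg K h := by
  unfold foldAvg
  gcongr with j _ i hi
  exact hgh j i hi

lemma foldAvg_add (g h : Fin k → Fin n → ℝ) :
    foldAvg K (fun j i => g j i + h j i) = foldAvg K g + foldAvg K h := by
  simp only [foldAvg, Finset.sum_add_distrib, mul_add]

lemma foldAvg_const_on_folds (hK : IsFoldPartition K) (c : Fin k → ℝ) :
    foldAvg K (fun j _ => c j) = (1 / (k : ℝ)) * ∑ j, c j := by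
  unfold foldAvg
  congr 1
  refine Finset.sum_congr rfl fun j _ => ?_
  have : ((K j).card : ℝ) ≠ 0 := by exact_mod_cast (hK.nonempty j).card_pos.ne'
  rw [Finset.sum_const, nsmul_eq_mul]
  field_simp

lemma foldAvg_nonneg {g : Fin k → Fin n → ℝ} (hg : ∀ j i, 0 ≤ g j i) : 0 ≤ foldAvg K g := by
  have := foldAvg_mono (K := K) (g := fun _ _ => 0) (h := g) fun j i _ => hg j i
  simpa [foldAvg] using this

lemma foldAvg_le_one (hK : IsFoldPartition K) {g : Fin k → Fin n → ℝ} (hg : ∀ j i, g j i ≤ 1) :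
    foldAvg K g ≤ 1 := by
  refine (foldAvg_mono (h := fun _ _ => 1) fun j i _ => hg j i).trans ?_
  rw [foldAvg_const_on_folds hK fun _ => 1]
  rcases eq_or_ne k 0 with rfl | hk
  · simp
  · have : (k : ℝ) ≠ 0 := by exact_mod_cast hk
    simp [this]

lemma measurable_foldAvg {β : Type*} [MeasurableSpace β] {g : β → Fin k → Fin n → ℝ}
    (hg : ∀ j i, Measurable fun b => g b j i) : Measurable fun b => foldAvg K (g b) := by
  unfold foldAvg
  fun_prop

lemma foldCdf_nonneg (v : Fin k → Fin n → ℝ) (t : ℝ) : 0 ≤ foldCdf K v t :=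
  foldAvg_nonneg fun j i => by positivity

lemma foldCdf_le_one (hK : IsFoldPartition K) (v : Fin k → Fin n → ℝ) (t : ℝ) :
    foldCdf K v t ≤ 1 :=
  foldAvg_le_one hK fun j i => by split_ifs <;> norm_num

lemma foldCdf_mono (K : Fin k → Finset (Fin n)) (v : Fin k → Fin n → ℝ) :
    Monotone (foldCdf K v) := fun s t hst => by
  refine foldAvg_mono fun j i _ => ?_
  split_ifs <;> linarith

lemma foldCdfLT_mono (K : Fin k → Finset (Fin n)) (v : Fin k → Fin n → ℝ) :
    Monotone (foldCdfLT K v) := fun s t hst => by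
  refine foldAvg_mono fun j i _ => ?_
  split_ifs <;> linarith

lemma foldCdfLT_le_foldCdf (v : Fin k → Fin n → ℝ) (t : ℝ) :
    foldCdfLT K v t ≤ foldCdf K v t := by
  refine foldAvg_mono fun j i _ => ?_
  split_ifs <;> linarith

lemma foldCdf_le_foldCdfLT_of_lt (v : Fin k → Fin n → ℝ) {s t : ℝ} (hst : s < t) :
    foldCdf K v s ≤ foldCdfLT K v t := by
  refine foldAvg_mono fun j i _ => ?_
  split_ifs <;> linarith

/-- A step function attains its left limit at some point to the left. -/
lemma exists_lt_foldCdf_eq_foldCdfLT (K : Fin k → Finset (Fin n)) (v : Fin k → Fin n → ℝ)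
    (t : ℝ) : ∃ s < t, foldCdf K v s = foldCdfLT K v t := by
  have h : ∀ᶠ s in 𝓝[<] t, ∀ j i, (v j i ≤ s ↔ v j i < t) := by
    rw [eventually_all]; intro j
    rw [eventually_all]; intro i
    rcases lt_or_ge (v j i) t with h | h
    · filter_upwards [Ioo_mem_nhdsLT h] with s hs
      simp [hs.1.le, h]
    · filter_upwards [self_mem_nhdsWithin] with s hs
      simp only [h.not_gt, iff_false, not_le]
      exact lt_of_lt_of_le hs h
  obtain ⟨s, hs, hst⟩ := (h.and self_mem_nhdsWithin).exists
  refine ⟨s, hst, ?_⟩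
  simp only [foldCdf_eq_foldAvg, foldCdfLT, hs]

/-- A right-continuous step function is constant on some interval to the right of each point. -/
lemma exists_gt_foldCdf_eq (K : Fin k → Finset (Fin n)) (v : Fin k → Fin n → ℝ)
    (t : ℝ) : ∃ s > t, foldCdf K v s = foldCdf K v t := by
  have h : ∀ᶠ s in 𝓝[>] t, ∀ j i, (v j i ≤ s ↔ v j i ≤ t) := by
    rw [eventually_all]; intro j
    rw [eventually_all]; intro i
    rcases lt_or_ge t (v j i) with h | h
    · filter_upwards [Ioo_mem_nhdsGT h] with s hs
      simp only [hs.2.not_ge, h.not_ge]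
    · filter_upwards [self_mem_nhdsWithin] with s hs
      refine iff_of_true ?_ h
      exact h.trans (le_of_lt hs)
  obtain ⟨s, hs, hst⟩ := (h.and self_mem_nhdsWithin).exists
  refine ⟨s, hst, ?_⟩
  simp only [foldCdf_eq_foldAvg, hs]

lemma quantile_foldCdf_le_iff (v : Fin k → Fin n → ℝ) (a t : ℝ) :
    quantile a (foldCdf K v) ≤ (t : EReal) ↔ a ≤ foldCdf K v t := by
  constructor
  · intro h
    by_contra! hlt
    obtain ⟨s, hs, hs'⟩ := exists_gt_foldCdf_eq K v t
    have : (s : EReal) ≤ quantile a (foldCdf K v) := by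
      refine le_sInf ?_
      rintro _ ⟨x, hx, rfl⟩
      rw [EReal.coe_le_coe_iff]
      by_contra! hxs
      have := foldCdf_mono K v hxs.le
      simp only [Set.mem_ofPred_eq] at hx
      linarith
    have := this.trans h
    rw [EReal.coe_le_coe_iff] at this
    linarith
  · exact fun h => sInf_le ⟨t, h, rfl⟩

lemma le_quantile_foldCdf_iff (v : Fin k → Fin n → ℝ) (a t : ℝ) :
    (t : EReal) ≤ quantile a (foldCdf K v) ↔ foldCdfLT K v t < a := by
  constructor
  · intro h
    by_contra! hle
    obtain ⟨s, hs, hs'⟩ := exists_lt_foldCdf_eq_foldCdfLT K v t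
    have := h.trans (sInf_le (⟨s, by simpa [hs'] using hle, rfl⟩ : (s : EReal) ∈ _ '' _))
    rw [EReal.coe_le_coe_iff] at this
    linarith
  · intro h
    refine le_sInf ?_
    rintro _ ⟨x, hx, rfl⟩
    rw [EReal.coe_le_coe_iff]
    by_contra! hxt
    have := foldCdf_le_foldCdfLT_of_lt (K := K) v hxt
    simp only [Set.mem_ofPred_eq] at hx
    linarith

/-- Membership in a prediction interval, in terms of the distribution function and its left limit
instead of quantiles. -/
lemma mem_distortedInterval_iff (v : Fin k → Fin n → ℝ) (α : ℝ × ℝ) (δ y : ℝ) :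
    y ∈ distortedInterval (foldCdf K v) α δ ↔
      α.1 ≤ foldCdf K v (y + δ) ∧ foldCdfLT K v (y - δ) < α.2 := by
  unfold distortedInterval
  rw [Set.mem_ofPred_eq, ← quantile_foldCdf_le_iff, ← le_quantile_foldCdf_iff,
    EReal.sub_le_iff_le_add (.inl (EReal.coe_ne_bot δ)) (.inl (EReal.coe_ne_top δ)),
    EReal.coe_add, EReal.coe_sub,
    EReal.sub_le_iff_le_add (.inl (EReal.coe_ne_bot δ)) (.inl (EReal.coe_ne_top δ))]

/-- The proportion of folds `j` with `η ≤ d j`. -/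
noncomputable def foldProportion (η : ℝ) (d : Fin k → ℝ) : ℝ :=
  (1 / (k : ℝ)) * ∑ j, (if η ≤ d j then 1 else 0)

/-- If the values `v` and `v'` differ by at least `η` only on a proportion `ε` of the folds, then
their distribution functions are within Lévy distance `max η ε`. -/
lemma foldCdf_le_of_close (hK : IsFoldPartition K) {v v' : Fin k → Fin n → ℝ} {d : Fin k → ℝ}
    (hd : ∀ j, ∀ i ∈ K j, |v j i - v' j i| ≤ d j) (η t : ℝ) :
    foldCdf K v t ≤ foldCdf K v' (t + η) + foldProportion η d := by
  rw [foldProportion, ← foldAvg_const_on_folds hK, foldCdf_eq_foldAvg, foldCdf_eq_foldAvg,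
    ← foldAvg_add]
  refine foldAvg_mono fun j i hi => ?_
  have := abs_le.1 (hd j i hi)
  split_ifs <;> linarith

lemma foldCdfLT_le_of_close (hK : IsFoldPartition K) {v v' : Fin k → Fin n → ℝ} {d : Fin k → ℝ}
    (hd : ∀ j, ∀ i ∈ K j, |v j i - v' j i| ≤ d j) (η t : ℝ) :
    foldCdfLT K v' (t - η) ≤ foldCdfLT K v t + foldProportion η d := by
  rw [foldProportion, ← foldAvg_const_on_folds hK, foldCdfLT, foldCdfLT, ← foldAvg_add]
  refine foldAvg_mono fun j i hi => ?_
  have := abs_le.1 (hd j i hi)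
  split_ifs <;> linarith

lemma foldCdf_const_add (v : Fin k → Fin n → ℝ) (c t : ℝ) :
    foldCdf K (fun j i => c + v j i) t = foldCdf K v (t - c) := by
  simp only [foldCdf_eq_foldAvg, le_sub_iff_add_le']

lemma foldCdfLT_const_add (v : Fin k → Fin n → ℝ) (c t : ℝ) :
    foldCdfLT K (fun j i => c + v j i) t = foldCdfLT K v (t - c) := by
  simp only [foldCdfLT, lt_sub_iff_add_lt']

end FoldAverages

/-! ### The joint law of training data and new pair -/

section Law

variable {Ω : Type*} [MeasurableSpace Ω] {μ : Measure Ω} {p n : ℕ} {P : Measure (Obs p)}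
  {Z : Fin (n + 1) → Ω → Obs p}

lemma IsIIDSample.measurable_trainingData (hZ : IsIIDSample μ P Z) :
    Measurable (trainingData Z) :=
  measurable_pi_lambda _ fun i => hZ.measurable i.castSucc

lemma IsIIDSample.measurable_newObs (hZ : IsIIDSample μ P Z) : Measurable (newObs Z) :=
  hZ.measurable _

variable [IsProbabilityMeasure P]

lemma IsIIDSample.map_newObs_trainingData [IsProbabilityMeasure μ] (hZ : IsIIDSample μ P Z) :
    μ.map (fun ω => (newObs Z ω, trainingData Z ω)) = P.prod (Measure.pi fun _ => P) := by
  have h1 : μ.map (fun ω i => Z i ω) = Measure.pi fun _ => P := by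
    rw [hZ.indep.map_fun_eq_pi_map fun i => (hZ.measurable i).aemeasurable]
    simp only [hZ.law]
  have h2 := (measurePreserving_piFinSuccAbove (fun _ : Fin (n + 1) => P) (Fin.last n)).map_eq
  rw [← h1, Measure.map_map (MeasurableEquiv.measurable _)
    (measurable_pi_lambda _ hZ.measurable)] at h2
  rw [← h2]
  congr 1
  funext ω
  simp only [Function.comp_apply, MeasurableEquiv.piFinSuccAbove, Fin.insertNthEquiv_last]
  rfl

lemma IsIIDSample.map_pair [IsProbabilityMeasure μ] (hZ : IsIIDSample μ P Z) :
    μ.map (fun ω => (trainingData Z ω, newObs Z ω)) = (Measure.pi fun _ => P).prod P := by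
  rw [← Measure.prod_swap, ← hZ.map_newObs_trainingData, Measure.map_map measurable_swap
    (hZ.measurable_newObs.prodMk hZ.measurable_trainingData)]
  rfl

lemma IsIIDSample.map_trainingData [IsProbabilityMeasure μ] (hZ : IsIIDSample μ P Z) :
    μ.map (trainingData Z) = Measure.pi fun _ => P := by
  have h := congrArg (Measure.map Prod.fst) hZ.map_pair
  rw [Measure.map_map measurable_fst (hZ.measurable_trainingData.prodMk hZ.measurable_newObs),
    Measure.map_fst_prod] at h
  rw [measure_univ, one_smul] at h
  exact h

/-- The new pair is independent of the training data, so the conditional coverage probability of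
any family of prediction sets is computed with the unconditional law `P`, simultaneously for all
prediction sets outside a single null set. -/
lemma IsIIDSample.ae_condCoverage_eq [IsProbabilityMeasure μ] (hZ : IsIIDSample μ P Z) :
    ∀ᵐ ω ∂μ, ∀ PI : (Fin n → Obs p) → (Fin p → ℝ) → Set ℝ, condCoverage μ Z PI ω =
      P.real {z | z.1 ∈ PI (trainingData Z ω) z.2} := by
  have h : condDistrib (newObs Z) (trainingData Z) μ =ᵐ[μ.map (trainingData Z)]
      Kernel.const _ P := by
    refine condDistrib_ae_eq_of_measure_eq_compProd _ hZ.measurable_newObs.aemeasurable ?_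
    rw [hZ.map_pair, hZ.map_trainingData, Measure.compProd_const]
  filter_upwards [ae_of_ae_map hZ.measurable_trainingData.aemeasurable h] with ω hω PI
  simp only [condCoverage, hω, Kernel.const_apply]

end Law

/-! ### Coverage as a function of the training data -/

section Coverage

variable {p n k : ℕ} {P : Measure (Obs p)}
  {K : Fin k → Finset (Fin n)} {V : (Fin n → Obs p) → (Fin p → ℝ) → Fin k → Fin n → ℝ}

/-- The values `V T x` from which the distribution functions are built depend measurably on the
training data `T` and the new feature vector `x`. -/
def MeasurableScore (V : (Fin n → Obs p) → (Fin p → ℝ) → Fin k → Fin n → ℝ) : Prop :=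
  ∀ j i, Measurable fun q : (Fin n → Obs p) × (Fin p → ℝ) => V q.1 q.2 j i

/-- The probability that a new pair falls into the `δ`-distorted interval built from the values
`V T x`, for fixed training data `T`. -/
noncomputable def coverage (P : Measure (Obs p)) (K : Fin k → Finset (Fin n))
    (V : (Fin n → Obs p) → (Fin p → ℝ) → Fin k → Fin n → ℝ) (δ : ℝ) (α : ℝ × ℝ)
    (T : Fin n → Obs p) : ℝ :=
  P.real {z | z.1 ∈ distortedInterval (foldCdf K (V T z.2)) α δ}

/-- The largest deviation of the coverage from its nominal level. -/
noncomputable def maxCoverageError (P : Measure (Obs p)) (K : Fin k → Finset (Fin n))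
    (V : (Fin n → Obs p) → (Fin p → ℝ) → Fin k → Fin n → ℝ) (δ : ℝ) (T : Fin n → Obs p) : ℝ :=
  ⨆ α : levels, |coverage P K V δ α T - (α.1.2 - α.1.1)|

lemma MeasurableScore.measurable_foldCdf (hV : MeasurableScore V) (δ : ℝ) :
    Measurable fun q : (Fin n → Obs p) × Obs p => foldCdf K (V q.1 q.2.2) (q.2.1 + δ) := by
  refine measurable_foldAvg fun j i => Measurable.ite (measurableSet_le ?_ (by fun_prop))
    measurable_const measurable_const
  exact (hV j i).comp (f := fun q : (Fin n → Obs p) × Obs p => (q.1, q.2.2)) (by fun_prop)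

lemma MeasurableScore.measurable_foldCdfLT (hV : MeasurableScore V) (δ : ℝ) :
    Measurable fun q : (Fin n → Obs p) × Obs p => foldCdfLT K (V q.1 q.2.2) (q.2.1 + δ) := by
  refine measurable_foldAvg fun j i => Measurable.ite (measurableSet_lt ?_ (by fun_prop))
    measurable_const measurable_const
  exact (hV j i).comp (f := fun q : (Fin n → Obs p) × Obs p => (q.1, q.2.2)) (by fun_prop)

lemma coverage_nonneg (δ : ℝ) (α : ℝ × ℝ) (T : Fin n → Obs p) : 0 ≤ coverage P K V δ α T :=
  measureReal_nonneg

variable [IsProbabilityMeasure P]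

lemma coverage_le_one (δ : ℝ) (α : ℝ × ℝ) (T : Fin n → Obs p) : coverage P K V δ α T ≤ 1 :=
  measureReal_le_one

lemma coverage_mono (δ : ℝ) {α β : ℝ × ℝ} (h1 : β.1 ≤ α.1) (h2 : α.2 ≤ β.2)
    (T : Fin n → Obs p) : coverage P K V δ α T ≤ coverage P K V δ β T := by
  refine measureReal_mono fun z hz => ?_
  simp only [Set.mem_ofPred_eq, mem_distortedInterval_iff] at hz ⊢
  exact ⟨h1.trans hz.1, hz.2.trans_le h2⟩

lemma zero_mem_levels : ((0, 0) : ℝ × ℝ) ∈ levels := ⟨le_rfl, le_rfl, zero_le_one⟩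

instance : Nonempty levels := ⟨⟨_, zero_mem_levels⟩⟩

lemma abs_coverage_sub_le_one (δ : ℝ) (T : Fin n → Obs p) (α : levels) :
    |coverage P K V δ α T - (α.1.2 - α.1.1)| ≤ 1 := by
  obtain ⟨α, h1, h2, h3⟩ := α
  have := coverage_nonneg (P := P) (K := K) (V := V) δ α T
  have := coverage_le_one (P := P) (K := K) (V := V) δ α T
  rw [abs_le]
  constructor <;> dsimp only <;> linarith

lemma bddAbove_coverageError (δ : ℝ) (T : Fin n → Obs p) :
    BddAbove (Set.range fun α : levels => |coverage P K V δ α T - (α.1.2 - α.1.1)|) :=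
  ⟨1, by rintro _ ⟨α, rfl⟩; exact abs_coverage_sub_le_one δ T α⟩

lemma abs_coverage_sub_le_maxCoverageError (δ : ℝ) (T : Fin n → Obs p) {α : ℝ × ℝ}
    (hα : α ∈ levels) : |coverage P K V δ α T - (α.2 - α.1)| ≤ maxCoverageError P K V δ T :=
  le_ciSup (bddAbove_coverageError δ T) ⟨α, hα⟩

lemma maxCoverageError_nonneg (δ : ℝ) (T : Fin n → Obs p) : 0 ≤ maxCoverageError P K V δ T :=
  (abs_nonneg _).trans (abs_coverage_sub_le_maxCoverageError δ T zero_mem_levels)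

lemma maxCoverageError_le_one (δ : ℝ) (T : Fin n → Obs p) : maxCoverageError P K V δ T ≤ 1 :=
  ciSup_le fun α => abs_coverage_sub_le_one δ T α

lemma measurable_measureReal_section {β γ : Type*} [MeasurableSpace β] [MeasurableSpace γ]
    {ν : Measure γ} [IsProbabilityMeasure ν] {s : Set (β × γ)} (hs : MeasurableSet s) :
    Measurable fun b => ν.real {c | (b, c) ∈ s} :=
  (measurable_measure_prodMk_left hs).ennreal_toReal

lemma integral_measureReal_section {β γ : Type*} [MeasurableSpace β] [MeasurableSpace γ]
    {μ : Measure β} {ν : Measure γ} [IsProbabilityMeasure μ] [IsProbabilityMeasure ν]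
    {s : Set (β × γ)} (hs : MeasurableSet s) :
    ∫ b, ν.real {c | (b, c) ∈ s} ∂μ = (μ.prod ν).real s := by
  have hsec (b : β) : MeasurableSet {c | (b, c) ∈ s} := measurable_prodMk_left hs
  have hint : Integrable (s.indicator (1 : β × γ → ℝ)) (μ.prod ν) :=
    (integrable_const (1 : ℝ)).indicator hs
  rw [← integral_indicator_one hs, integral_prod _ hint]
  refine integral_congr_ae (ae_of_all _ fun b => ?_)
  simp only
  rw [← integral_indicator_one (hsec b)]
  rfl

lemma MeasurableScore.measurable_coverage (hV : MeasurableScore V) (δ : ℝ) (α : ℝ × ℝ) :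
    Measurable (coverage P K V δ α) := by
  have : MeasurableSet {q : (Fin n → Obs p) × Obs p |
      α.1 ≤ foldCdf K (V q.1 q.2.2) (q.2.1 + δ) ∧
      foldCdfLT K (V q.1 q.2.2) (q.2.1 - δ) < α.2} :=
    (measurableSet_le measurable_const (hV.measurable_foldCdf δ)).inter
      (measurableSet_lt
        (by simpa only [sub_eq_add_neg] using hV.measurable_foldCdfLT (K := K) (-δ))
        measurable_const)
  convert measurable_measureReal_section (ν := P) this using 1
  funext T
  simp only [coverage, mem_distortedInterval_iff]
  rfl

/-- By monotonicity of the coverage in both levels, rational levels determine the supremum. -/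
lemma maxCoverageError_eq_iSup_rat (δ : ℝ) (T : Fin n → Obs p) :
    maxCoverageError P K V δ T = ⨆ q : {q : ℚ × ℚ // 0 ≤ q.1 ∧ q.1 ≤ q.2 ∧ q.2 ≤ 1},
      |coverage P K V δ (q.1.1, q.1.2) T - ((q.1.2 : ℝ) - (q.1.1 : ℝ))| := by
  set S := ⨆ q : {q : ℚ × ℚ // 0 ≤ q.1 ∧ q.1 ≤ q.2 ∧ q.2 ≤ 1},
      |coverage P K V δ (q.1.1, q.1.2) T - ((q.1.2 : ℝ) - (q.1.1 : ℝ))| with hS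
  have mem (q : {q : ℚ × ℚ // 0 ≤ q.1 ∧ q.1 ≤ q.2 ∧ q.2 ≤ 1}) :
      ((q.1.1 : ℝ), (q.1.2 : ℝ)) ∈ levels := by
    obtain ⟨q, h1, h2, h3⟩ := q
    exact ⟨Rat.cast_nonneg.2 h1, Rat.cast_le.2 h2, by simpa using (Rat.cast_le (K := ℝ)).2 h3⟩
  have bdd : BddAbove (Set.range fun q : {q : ℚ × ℚ // 0 ≤ q.1 ∧ q.1 ≤ q.2 ∧ q.2 ≤ 1} =>
      |coverage P K V δ (q.1.1, q.1.2) T - ((q.1.2 : ℝ) - (q.1.1 : ℝ))|) :=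
    ⟨1, by rintro _ ⟨q, rfl⟩; exact abs_coverage_sub_le_one δ T ⟨_, mem q⟩⟩
  have le_S (a b : ℚ) (h1 : 0 ≤ a) (h2 : a ≤ b) (h3 : b ≤ 1) :
      |coverage P K V δ (a, b) T - ((b : ℝ) - (a : ℝ))| ≤ S :=
    le_ciSup bdd ⟨(a, b), h1, h2, h3⟩
  have : Nonempty {q : ℚ × ℚ // 0 ≤ q.1 ∧ q.1 ≤ q.2 ∧ q.2 ≤ 1} :=
    ⟨⟨(0, 0), le_rfl, le_rfl, zero_le_one⟩⟩
  -- a rational number slightly below or above a given level, without leaving `[0, 1]`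
  have below (a : ℝ) (ha : 0 ≤ a) (ε : ℝ) (hε : 0 < ε) : ∃ q : ℚ, 0 ≤ q ∧ q ≤ a ∧ a - ε < q := by
    rcases ha.eq_or_lt with rfl | ha
    · exact ⟨0, le_rfl, by simp, by simpa using hε⟩
    · obtain ⟨q, h1, h2⟩ := exists_rat_btwn (max_lt (sub_lt_self a hε) ha)
      rw [max_lt_iff] at h1
      exact ⟨q, by exact_mod_cast h1.2.le, h2.le, h1.1⟩
  have above (a : ℝ) (ha : a ≤ 1) (ε : ℝ) (hε : 0 < ε) : ∃ q : ℚ, q ≤ 1 ∧ a ≤ q ∧ q < a + ε := by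
    obtain ⟨q, h1, h2, h3⟩ := below (1 - a) (by linarith) ε hε
    exact ⟨1 - q, by linarith, by push_cast; linarith, by push_cast; linarith⟩
  refine le_antisymm (ciSup_le fun ⟨α, h0, h1, h2⟩ => ?_)
    (ciSup_le fun q => abs_coverage_sub_le_maxCoverageError δ T (mem q))
  refine le_of_forall_pos_le_add fun ε hε => ?_
  rw [abs_le]
  constructor
  · obtain ⟨a, ha1, ha2, ha3⟩ := above α.1 (h1.trans h2) (ε / 2) (by positivity)
    obtain ⟨b, hb1, hb2, hb3⟩ := below α.2 (h0.trans h1) (ε / 2) (by positivity)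
    rcases le_total a b with hab | hab
    · have hb : (b : ℝ) ≤ 1 := hb2.trans h2
      have := (abs_le.1 (le_S a b (by exact_mod_cast h0.trans ha2) hab
        (by exact_mod_cast hb))).1
      have := coverage_mono (P := P) (K := K) (V := V) δ (α := (a, b)) (β := α) ha2 hb2 T
      linarith
    · have hab : (b : ℝ) ≤ a := by exact_mod_cast hab
      have := (abs_nonneg _).trans (le_S 0 0 le_rfl le_rfl zero_le_one)
      have := coverage_nonneg (P := P) (K := K) (V := V) δ α T
      dsimp only
      linarith
  · obtain ⟨a, ha1, ha2, ha3⟩ := below α.1 h0 (ε / 2) (by positivity)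
    obtain ⟨b, hb1, hb2, hb3⟩ := above α.2 h2 (ε / 2) (by positivity)
    have hab : (a : ℝ) ≤ b := ha2.trans (h1.trans hb2)
    have := (abs_le.1 (le_S a b ha1 (by exact_mod_cast hab) hb1)).2
    have := coverage_mono (P := P) (K := K) (V := V) δ (α := α) (β := (a, b)) ha2 hb2 T
    dsimp only
    linarith

lemma MeasurableScore.measurable_maxCoverageError (hV : MeasurableScore V) (δ : ℝ) :
    Measurable (maxCoverageError P K V δ) := by
  have : (maxCoverageError P K V δ) = fun T =>
      ⨆ q : {q : ℚ × ℚ // 0 ≤ q.1 ∧ q.1 ≤ q.2 ∧ q.2 ≤ 1},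
      |coverage P K V δ (q.1.1, q.1.2) T - ((q.1.2 : ℝ) - (q.1.1 : ℝ))| :=
    funext fun T => maxCoverageError_eq_iSup_rat δ T
  rw [this]
  refine Measurable.iSup fun q => ?_
  have := hV.measurable_coverage (P := P) (K := K) δ (q.1.1, q.1.2)
  exact (this.sub_const _).abs

end Coverage

/-! ### Thin sets under a bounded conditional density -/

section ThinSets

variable {p : ℕ} {P : Measure (Obs p)} [IsProbabilityMeasure P]

instance : IsMarkovKernel (condLaw P) := by
  unfold condLaw
  infer_instance

/-- If `y` has a conditional density given `x` that exceeds `L` only with probability `ε`, then a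
set whose `x`-sections have diameter at most `η` has probability at most `ε + η L`. -/
lemma measureReal_le_of_sections_thin {L : ℝ≥0} {ε η : ℝ}
    (hP : ∀ᵐ x ∂(P.map Prod.snd), condLaw P x ≪ volume ∧ densitySup P x < ∞)
    (hL : (P.map Prod.snd).real {x | (L : ℝ≥0∞) < densitySup P x} ≤ ε)
    {B : Set (Obs p)} (hB : MeasurableSet B) (hη : 0 ≤ η)
    (hthin : ∀ x y y', (y, x) ∈ B → (y', x) ∈ B → y' ≤ y + η) :
    P.real B ≤ ε + η * L := by
  have : IsProbabilityMeasure (P.map Prod.snd) :=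
    Measure.isProbabilityMeasure_map measurable_snd.aemeasurable
  have hε : 0 ≤ ε := measureReal_nonneg.trans hL
  -- `densitySup P` need not be measurable, so the exceptional set is replaced by a measurable hull
  set N := toMeasurable (P.map Prod.snd) {x | (L : ℝ≥0∞) < densitySup P x} with hN
  have hcomp : (P.map Prod.snd) ⊗ₘ condLaw P = P.map Prod.swap :=
    compProd_map_condDistrib measurable_fst.aemeasurable
  have hPB : P B = ∫⁻ x, condLaw P x {y | (y, x) ∈ B} ∂(P.map Prod.snd) := by
    have h1 : P B = (P.map Prod.swap) (Prod.swap ⁻¹' B) := by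
      rw [Measure.map_apply measurable_swap (measurable_swap hB)]
      congr 1
    rw [h1, ← hcomp, Measure.compProd_apply (measurable_swap hB)]
    rfl
  have hbound : ∀ᵐ x ∂(P.map Prod.snd), condLaw P x {y | (y, x) ∈ B} ≤
      N.indicator 1 x + ENNReal.ofReal η * L := by
    filter_upwards [hP] with x hx
    by_cases hxN : x ∈ N
    · rw [Set.indicator_of_mem hxN]
      exact le_add_right (prob_le_one (μ := condLaw P x))
    · have hxL : densitySup P x ≤ L := by
        by_contra! h
        exact hxN (subset_toMeasurable _ _ h)
      rw [Set.indicator_of_notMem hxN, zero_add]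
      have hBx : MeasurableSet {y | (y, x) ∈ B} := hB.preimage (by fun_prop)
      have hvol : volume {y | (y, x) ∈ B} ≤ ENNReal.ofReal η := by
        refine (Real.volume_le_diam _).trans (Metric.ediam_le fun y hy y' hy' => ?_)
        rw [edist_dist, Real.dist_eq]
        refine ENNReal.ofReal_le_ofReal (abs_le.2 ⟨?_, ?_⟩)
        · linarith [hthin x y y' hy hy']
        · linarith [hthin x y' y hy' hy]
      rw [← Measure.setLIntegral_rnDeriv hx.1]
      calc ∫⁻ y in {y | (y, x) ∈ B}, (condLaw P x).rnDeriv volume y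
          ≤ ∫⁻ y in {y | (y, x) ∈ B}, densitySup P x :=
            lintegral_mono_ae (ae_restrict_of_ae (ENNReal.ae_le_essSup _))
        _ = densitySup P x * volume {y | (y, x) ∈ B} := by simp
        _ ≤ L * ENNReal.ofReal η := by gcongr
        _ = _ := mul_comm _ _
  have hN' : (P.map Prod.snd) N ≤ ENNReal.ofReal ε := by
    rw [hN, measure_toMeasurable]
    exact (ENNReal.le_ofReal_iff_toReal_le (measure_ne_top _ _) hε).2 hL
  have key : P B ≤ ENNReal.ofReal (ε + η * L) := by
    rw [hPB]
    refine (lintegral_mono_ae hbound).trans ?_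
    rw [lintegral_add_right _ measurable_const, lintegral_indicator_one
      (measurableSet_toMeasurable _ _), lintegral_const, measure_univ, mul_one,
      ENNReal.ofReal_add hε (by positivity), ENNReal.ofReal_mul hη, ENNReal.ofReal_coe_nnreal]
    gcongr
  exact ENNReal.toReal_le_of_le_ofReal (by positivity) key

end ThinSets

/-! ### Comparison of the coverage for nearby values -/

section Comparison

variable {p n k : ℕ} {P : Measure (Obs p)}
  {K : Fin k → Finset (Fin n)} {V V' : (Fin n → Obs p) → (Fin p → ℝ) → Fin k → Fin n → ℝ}
  {d : (Fin n → Obs p) → (Fin p → ℝ) → Fin k → ℝ}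

/-- Sets whose `x`-sections have diameter at most `η` have probability at most `w`. -/
def ThinSetsSmall (P : Measure (Obs p)) (η w : ℝ) : Prop :=
  ∀ B : Set (Obs p), MeasurableSet B →
    (∀ x y y', (y, x) ∈ B → (y', x) ∈ B → y' ≤ y + η) → P.real B ≤ w

/-- For fixed training data, the probability that `η ≤ d j` for a proportion larger than `ε` of
the folds `j`. -/
noncomputable def unstableProb (P : Measure (Obs p))
    (d : (Fin n → Obs p) → (Fin p → ℝ) → Fin k → ℝ) (η ε : ℝ) (T : Fin n → Obs p) : ℝ :=
  P.real {z | ε < foldProportion η (d T z.2)}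

lemma coverage_zero_left (c : ℝ) (T : Fin n → Obs p) :
    coverage P K V 0 (0, c) T = P.real {z | foldCdfLT K (V T z.2) z.1 < c} := by
  simp only [coverage, mem_distortedInterval_iff, add_zero, sub_zero, foldCdf_nonneg, true_and]

lemma MeasurableScore.measurable_foldCdf_right (hV : MeasurableScore V) (T : Fin n → Obs p)
    (δ : ℝ) : Measurable fun z : Obs p => foldCdf K (V T z.2) (z.1 + δ) := by
  have h := hV.measurable_foldCdf (K := K) δ
  exact h.comp (g := fun q : (Fin n → Obs p) × Obs p => foldCdf K (V q.1 q.2.2) (q.2.1 + δ))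
    (f := fun z : Obs p => (T, z)) measurable_prodMk_left

lemma MeasurableScore.measurable_foldCdfLT_right (hV : MeasurableScore V) (T : Fin n → Obs p)
    (δ : ℝ) : Measurable fun z : Obs p => foldCdfLT K (V T z.2) (z.1 + δ) := by
  have h := hV.measurable_foldCdfLT (K := K) δ
  exact h.comp (g := fun q : (Fin n → Obs p) × Obs p => foldCdfLT K (V q.1 q.2.2) (q.2.1 + δ))
    (f := fun z : Obs p => (T, z)) measurable_prodMk_left

lemma measureReal_foldCdf_between (hV : MeasurableScore V) {η w : ℝ} (hP : ThinSetsSmall P η w)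
    (T : Fin n → Obs p) (c δ δ' : ℝ) (hδ : δ' ≤ δ + η) :
    P.real {z : Obs p | foldCdf K (V T z.2) (z.1 + δ) < c ∧
      c ≤ foldCdf K (V T z.2) (z.1 + δ')} ≤ w := by
  refine hP _ ((measurableSet_lt (hV.measurable_foldCdf_right T δ) measurable_const).inter
    (measurableSet_le measurable_const (hV.measurable_foldCdf_right T δ'))) fun x y y' h h' => ?_
  by_contra! hlt
  have := foldCdf_mono K (V T x) (show y + δ' ≤ y' + δ by linarith)
  exact absurd (h.2.trans this) h'.1.not_ge

lemma measureReal_foldCdfLT_between (hV : MeasurableScore V) {η w : ℝ}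
    (hP : ThinSetsSmall P η w) (T : Fin n → Obs p) (c δ δ' : ℝ) (hδ : δ' ≤ δ + η) :
    P.real {z : Obs p | foldCdfLT K (V T z.2) (z.1 + δ) < c ∧
      c ≤ foldCdfLT K (V T z.2) (z.1 + δ')} ≤ w := by
  refine hP _ ((measurableSet_lt (hV.measurable_foldCdfLT_right T δ) measurable_const).inter
    (measurableSet_le measurable_const (hV.measurable_foldCdfLT_right T δ'))) fun x y y' h h' => ?_
  by_contra! hlt
  have := foldCdfLT_mono K (V T x) (show y + δ' ≤ y' + δ by linarith)
  exact absurd (h.2.trans this) h'.1.not_ge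

variable [IsProbabilityMeasure P]

lemma coverage_le_of_close (hK : IsFoldPartition K)
    (hd : ∀ T x j, ∀ i ∈ K j, |V T x j i - V' T x j i| ≤ d T x j) (δ η ε : ℝ) (α : ℝ × ℝ)
    (T : Fin n → Obs p) :
    coverage P K V δ α T ≤
      coverage P K V' (δ + η) (α.1 - ε, α.2 + ε) T + unstableProb P d η ε T := by
  refine (measureReal_mono fun z hz => ?_).trans (measureReal_union_le _ _)
  by_cases hε : ε < foldProportion η (d T z.2)
  · exact Or.inr hε
  · left
    simp only [Set.mem_ofPred_eq, mem_distortedInterval_iff] at hz ⊢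
    have h1 := foldCdf_le_of_close hK (hd T z.2) η (z.1 + δ)
    have h2 := foldCdfLT_le_of_close hK (hd T z.2) η (z.1 - δ)
    rw [← add_assoc, ← sub_sub]
    constructor <;> linarith

/-- Conservative coverage carries over from `V` to nearby values `V'`, at the price of enlarging
the intervals by `η`. -/
lemma neg_le_coverage_sub_of_close (hK : IsFoldPartition K)
    (hd : ∀ T x j, ∀ i ∈ K j, |V T x j i - V' T x j i| ≤ d T x j) {δ η ε r : ℝ} (hε : 0 ≤ ε)
    (hr : 0 ≤ r) {T : Fin n → Obs p}
    (h : ∀ α ∈ levels, -r ≤ coverage P K V δ α T - (α.2 - α.1)) {α : ℝ × ℝ} (hα : α ∈ levels) :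
    -(r + 2 * ε + unstableProb P d η ε T) ≤ coverage P K V' (δ + η) α T - (α.2 - α.1) := by
  have hU : 0 ≤ unstableProb P d η ε T := measureReal_nonneg
  obtain ⟨h0, h1, h2⟩ := hα
  rcases le_total (α.1 + ε) (α.2 - ε) with hle | hle
  · have h3 := h (α.1 + ε, α.2 - ε) ⟨by dsimp only; linarith, hle, by dsimp only; linarith⟩
    have h4 := coverage_le_of_close (P := P) hK hd δ η ε (α.1 + ε, α.2 - ε) T
    simp only [add_sub_cancel_right, sub_add_cancel] at h3 h4
    linarith
  · have := coverage_nonneg (P := P) (K := K) (V := V') (δ + η) α T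
    linarith

/-- The two end strips that distinguish a `δ'`-distorted from a `δ`-distorted interval are thin. -/
lemma coverage_le_coverage_add_thin (hV : MeasurableScore V) {η w : ℝ}
    (hP : ThinSetsSmall P η w) (T : Fin n → Obs p) (α : ℝ × ℝ) {δ δ' : ℝ} (hδ : δ' ≤ δ + η) :
    coverage P K V δ' α T ≤ coverage P K V δ α T + 2 * w := by
  have h1 := measureReal_foldCdf_between (K := K) hV hP T α.1 δ δ' hδ
  have h2 := measureReal_foldCdfLT_between (K := K) hV hP T α.2 (-δ') (-δ) (by linarith)
  have h3 : coverage P K V δ' α T ≤ P.real (({z : Obs p | z.1 ∈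
      distortedInterval (foldCdf K (V T z.2)) α δ} ∪ _) ∪ _) :=
    measureReal_mono (s₂ := (_ ∪ {z : Obs p | foldCdf K (V T z.2) (z.1 + δ) < α.1 ∧
      α.1 ≤ foldCdf K (V T z.2) (z.1 + δ')}) ∪
      {z : Obs p | foldCdfLT K (V T z.2) (z.1 + -δ') < α.2 ∧
      α.2 ≤ foldCdfLT K (V T z.2) (z.1 + -δ)}) fun z hz => by
    simp only [Set.mem_ofPred_eq, mem_distortedInterval_iff, Set.mem_union,
      ← sub_eq_add_neg] at hz ⊢
    by_cases ha : α.1 ≤ foldCdf K (V T z.2) (z.1 + δ)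
    · by_cases hb : foldCdfLT K (V T z.2) (z.1 - δ) < α.2
      · exact Or.inl (Or.inl ⟨ha, hb⟩)
      · exact Or.inr ⟨hz.2, not_lt.1 hb⟩
    · exact Or.inl (Or.inr ⟨not_le.1 ha, hz.1⟩)
  have h4 := measureReal_union_le (μ := P) (({z : Obs p | z.1 ∈
      distortedInterval (foldCdf K (V T z.2)) α δ} ∪ {z : Obs p |
      foldCdf K (V T z.2) (z.1 + δ) < α.1 ∧ α.1 ≤ foldCdf K (V T z.2) (z.1 + δ')}))
      {z : Obs p | foldCdfLT K (V T z.2) (z.1 + -δ') < α.2 ∧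
      α.2 ≤ foldCdfLT K (V T z.2) (z.1 + -δ)}
  have h5 := measureReal_union_le (μ := P) {z : Obs p | z.1 ∈
      distortedInterval (foldCdf K (V T z.2)) α δ} {z : Obs p |
      foldCdf K (V T z.2) (z.1 + δ) < α.1 ∧ α.1 ≤ foldCdf K (V T z.2) (z.1 + δ')}
  have h6 : P.real {z : Obs p | z.1 ∈
      distortedInterval (foldCdf K (V T z.2)) α δ} = coverage P K V δ α T := rfl
  linarith

/-- Without atoms, the coverage of the two-sided interval is a difference of the coverages of
one-sided intervals, up to the probability of a thin set. -/
lemma abs_coverage_sub_one_sided_le (hV : MeasurableScore V) {η w : ℝ} (hη : 0 ≤ η)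
    (hP : ThinSetsSmall P η w) (T : Fin n → Obs p) {α : ℝ × ℝ} (hα : α.1 ≤ α.2) :
    |coverage P K V 0 α T - (coverage P K V 0 (0, α.2) T - coverage P K V 0 (0, α.1) T)| ≤ w := by
  rw [coverage_zero_left, coverage_zero_left]
  have hm : MeasurableSet {z : Obs p | foldCdf K (V T z.2) z.1 < α.1} := by
    simpa only [add_zero] using
      measurableSet_lt (hV.measurable_foldCdf_right (K := K) T 0) (measurable_const (a := α.1))
  have hm' : MeasurableSet {z : Obs p | foldCdfLT K (V T z.2) z.1 < α.1} := by
    simpa only [add_zero] using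
      measurableSet_lt (hV.measurable_foldCdfLT_right (K := K) T 0) (measurable_const (a := α.1))
  have hsplit : P.real {z | foldCdfLT K (V T z.2) z.1 < α.2} =
      coverage P K V 0 α T + P.real {z | foldCdf K (V T z.2) z.1 < α.1} := by
    rw [coverage, ← measureReal_union _ hm]
    · congr 1
      ext z
      have := foldCdfLT_le_foldCdf (K := K) (V T z.2) z.1
      simp only [Set.mem_union, Set.mem_ofPred_eq, mem_distortedInterval_iff, add_zero, sub_zero]
      constructor
      · intro h
        rcases lt_or_ge (foldCdf K (V T z.2) z.1) α.1 with h' | h'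
        · exact Or.inr h'
        · exact Or.inl ⟨h', h⟩
      · rintro (h | h)
        · exact h.2
        · exact this.trans_lt (h.trans_le hα)
    · rw [Set.disjoint_left]
      intro z hz
      simp only [Set.mem_ofPred_eq, mem_distortedInterval_iff, add_zero] at hz ⊢
      exact hz.1.not_gt
  have hle : P.real {z | foldCdf K (V T z.2) z.1 < α.1} ≤
      P.real {z | foldCdfLT K (V T z.2) z.1 < α.1} :=
    measureReal_mono fun z hz => (foldCdfLT_le_foldCdf (V T z.2) z.1).trans_lt hz
  have hthin : P.real ({z | foldCdfLT K (V T z.2) z.1 < α.1} \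
      {z | foldCdf K (V T z.2) z.1 < α.1}) ≤ w := by
    refine hP _ (hm'.diff hm) fun x y y' h h' => ?_
    by_contra! hlt
    have := foldCdf_le_foldCdfLT_of_lt (K := K) (V T x) (show y < y' by linarith)
    have h1 : foldCdfLT K (V T x) y' < α.1 := h'.1
    have h2 : ¬ foldCdf K (V T x) y < α.1 := h.2
    linarith
  have hge : P.real {z | foldCdfLT K (V T z.2) z.1 < α.1} ≤
      P.real {z | foldCdf K (V T z.2) z.1 < α.1} + w := by
    refine (measureReal_mono fun z hz => ?_).trans
      ((measureReal_union_le _ _).trans (add_le_add_right hthin _))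
    by_cases h : z ∈ {z | foldCdf K (V T z.2) z.1 < α.1}
    · exact Or.inl h
    · exact Or.inr ⟨hz, h⟩
  rw [abs_le]
  constructor <;> linarith

lemma one_sided_coverage_le_of_close (hK : IsFoldPartition K)
    (hd : ∀ T x j, ∀ i ∈ K j, |V T x j i - V' T x j i| ≤ d T x j)
    (hV' : MeasurableScore V') {η w : ℝ} (hP : ThinSetsSmall P η w) (ε c : ℝ)
    (T : Fin n → Obs p) :
    coverage P K V 0 (0, c) T ≤
      coverage P K V' 0 (0, c + ε) T + unstableProb P d η ε T + w := by
  have h := measureReal_foldCdfLT_between (K := K) hV' hP T (c + ε) (-η) 0 (by linarith)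
  rw [coverage_zero_left, coverage_zero_left]
  refine (measureReal_mono fun z hz => ?_).trans ((measureReal_union_le _ _).trans
    (add_le_add (measureReal_union_le _ _) h))
  by_cases hε : ε < foldProportion η (d T z.2)
  · exact Or.inl (Or.inr hε)
  · have h2 := foldCdfLT_le_of_close hK (hd T z.2) η z.1
    simp only [Set.mem_ofPred_eq, Set.mem_union, add_zero, ← sub_eq_add_neg] at hz ⊢
    by_cases h3 : foldCdfLT K (V' T z.2) z.1 < c + ε
    · exact Or.inl (Or.inl h3)
    · exact Or.inr ⟨by linarith, not_lt.1 h3⟩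

/-- In the continuous case, uniform validity carries over from `V'` to nearby values `V`. -/
lemma maxCoverageError_le_of_close (hK : IsFoldPartition K)
    (hd : ∀ T x j, ∀ i ∈ K j, |V T x j i - V' T x j i| ≤ d T x j)
    (hV : MeasurableScore V) (hV' : MeasurableScore V') {η w ε : ℝ} (hη : 0 ≤ η)
    (hP : ThinSetsSmall P η w) (hε : 0 ≤ ε) (T : Fin n → Obs p) :
    maxCoverageError P K V 0 T ≤
      2 * maxCoverageError P K V' 0 T + 2 * unstableProb P d η ε T + (2 * ε + 3 * w) := by
  set S := maxCoverageError P K V' 0 T with hS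
  have hS0 : 0 ≤ S := maxCoverageError_nonneg 0 T
  have hU : 0 ≤ unstableProb P d η ε T := measureReal_nonneg
  have hw : 0 ≤ w := measureReal_nonneg.trans (hP ∅ MeasurableSet.empty (by simp))
  have hd' : ∀ T x j, ∀ i ∈ K j, |V' T x j i - V T x j i| ≤ d T x j := fun T x j i hi => by
    rw [abs_sub_comm]; exact hd T x j i hi
  have key (c : ℝ) (h0 : 0 ≤ c) (h1 : c ≤ 1) :
      |coverage P K V 0 (0, c) T - c| ≤ S + ε + unstableProb P d η ε T + w := by
    have up (c : ℝ) (h0 : 0 ≤ c) (h1 : c ≤ 1) : |coverage P K V' 0 (0, c) T - c| ≤ S := by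
      simpa using abs_coverage_sub_le_maxCoverageError (P := P) (K := K) (V := V') 0 T
        (α := (0, c)) ⟨le_rfl, h0, h1⟩
    rw [abs_le]
    constructor
    · rcases le_total ε c with h | h
      · have h2 := one_sided_coverage_le_of_close (P := P) hK hd' hV hP ε (c - ε) T
        have h3 := (abs_le.1 (up (c - ε) (by linarith) (by linarith))).1
        rw [sub_add_cancel] at h2
        linarith
      · have := coverage_nonneg (P := P) (K := K) (V := V) 0 (0, c) T
        linarith
    · rcases le_total (c + ε) 1 with h | h
      · have h2 := one_sided_coverage_le_of_close (P := P) hK hd hV' hP ε c T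
        have h3 := (abs_le.1 (up (c + ε) (by linarith) h)).2
        linarith
      · have := coverage_le_one (P := P) (K := K) (V := V) 0 (0, c) T
        linarith
  refine ciSup_le fun ⟨α, h0, h1, h2⟩ => ?_
  have a1 := abs_le.1 (abs_coverage_sub_one_sided_le (P := P) (K := K) hV hη hP T h1)
  have a2 := abs_le.1 (key α.1 h0 (h1.trans h2))
  have a3 := abs_le.1 (key α.2 (h0.trans h1) h2)
  rw [abs_le]
  constructor <;> dsimp only <;> linarith

lemma measurable_foldProportion (hd : ∀ j, Measurable fun q : (Fin n → Obs p) × (Fin p → ℝ) =>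
    d q.1 q.2 j) (η : ℝ) :
    Measurable fun q : (Fin n → Obs p) × Obs p => foldProportion η (d q.1 q.2.2) := by
  refine Measurable.const_mul (Finset.measurable_fun_sum _ fun j _ => ?_) _
  refine Measurable.ite (measurableSet_le measurable_const ?_) measurable_const measurable_const
  exact (hd j).comp (f := fun q : (Fin n → Obs p) × Obs p => (q.1, q.2.2)) (by fun_prop)

lemma measurable_unstableProb (hd : ∀ j, Measurable fun q : (Fin n → Obs p) × (Fin p → ℝ) =>
    d q.1 q.2 j) (η ε : ℝ) : Measurable (unstableProb P d η ε) :=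
  measurable_measureReal_section (ν := P)
    (measurableSet_lt measurable_const (measurable_foldProportion hd η))

/-- Markov's inequality for the proportion of folds with `η ≤ d j`. -/
lemma integral_unstableProb_le (hd : ∀ j, Measurable fun q : (Fin n → Obs p) × (Fin p → ℝ) =>
    d q.1 q.2 j) (η : ℝ) {ε : ℝ} (hε : 0 < ε) :
    ∫ T, unstableProb P d η ε T ∂(Measure.pi fun _ => P) ≤ (1 / ε) * ((1 / (k : ℝ)) * ∑ j,
      ((Measure.pi fun _ => P).prod P).real
        {q : (Fin n → Obs p) × Obs p | η ≤ d q.1 q.2.2 j}) := by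
  set ρ := ((Measure.pi fun _ : Fin n => P).prod P) with hρ
  have hms (j) : MeasurableSet {q : (Fin n → Obs p) × Obs p | η ≤ d q.1 q.2.2 j} :=
    measurableSet_le measurable_const
      ((hd j).comp (f := fun q : (Fin n → Obs p) × Obs p => (q.1, q.2.2)) (by fun_prop))
  have hfm := measurable_foldProportion hd η
  have hsum : (fun q : (Fin n → Obs p) × Obs p => foldProportion η (d q.1 q.2.2)) =
      fun q => (1 / (k : ℝ)) * ∑ j,
        {q : (Fin n → Obs p) × Obs p | η ≤ d q.1 q.2.2 j}.indicator 1 q := by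
    funext q
    simp [foldProportion, Set.indicator_apply]
  have hint (j) : Integrable ({q : (Fin n → Obs p) × Obs p |
      η ≤ d q.1 q.2.2 j}.indicator (1 : (Fin n → Obs p) × Obs p → ℝ)) ρ :=
    (integrable_const (1 : ℝ)).indicator (hms j)
  have hintegral : ∫ q, foldProportion η (d q.1 q.2.2) ∂ρ = (1 / (k : ℝ)) * ∑ j, ρ.real
      {q : (Fin n → Obs p) × Obs p | η ≤ d q.1 q.2.2 j} := by
    rw [hsum, integral_const_mul, integral_finsetSum _ fun j _ => hint j]
    simp only [integral_indicator_one (hms _)]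
  have hset : MeasurableSet {q : (Fin n → Obs p) × Obs p |
      ε < foldProportion η (d q.1 q.2.2)} := measurableSet_lt measurable_const hfm
  have h1 : ∫ T, unstableProb P d η ε T ∂(Measure.pi fun _ => P) =
      ρ.real {q | ε < foldProportion η (d q.1 q.2.2)} := integral_measureReal_section hset
  have h2 := mul_meas_ge_le_integral_of_nonneg (μ := ρ) (f := fun q : (Fin n → Obs p) × Obs p =>
      foldProportion η (d q.1 q.2.2))
    (ae_of_all _ fun q => by unfold foldProportion; positivity)
    (by rw [hsum]; exact (integrable_finsetSum _ fun j _ => hint j).const_mul _) ε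
  rw [← hintegral, h1, one_div, ← div_eq_inv_mul, le_div_iff₀ hε, mul_comm]
  refine le_trans (mul_le_mul_of_nonneg_left (measureReal_mono fun q hq => ?_) hε.le) h2
  exact le_of_lt (Set.mem_ofPred_eq ▸ hq)

end Comparison

/-! ### Resampling a fold -/

section Resampling

variable {X : Type*} [MeasurableSpace X] {P : Measure X} [IsProbabilityMeasure P] {n : ℕ}

/-- Exchanging the coordinates in `s` between two independent samples preserves their law. -/
lemma measurePreserving_piecewise_swap (s : Finset (Fin n)) :
    MeasurePreserving (fun q : (Fin n → X) × (Fin n → X) =>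
      (s.piecewise q.2 q.1, s.piecewise q.1 q.2))
      ((Measure.pi fun _ => P).prod (Measure.pi fun _ => P))
      ((Measure.pi fun _ => P).prod (Measure.pi fun _ => P)) := by
  have h1 := measurePreserving_arrowProdEquivProdArrow X X (Fin n) (fun _ => P) (fun _ => P)
  have h2 : MeasurePreserving (fun (r : Fin n → X × X) i => if i ∈ s then (r i).swap else r i)
      (Measure.pi fun _ => P.prod P) (Measure.pi fun _ => P.prod P) := by
    refine measurePreserving_pi (fun _ : Fin n => P.prod P) (fun _ => P.prod P)
      (f := fun i z => if i ∈ s then z.swap else z) fun i => ?_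
    by_cases hi : i ∈ s
    · simpa only [hi, if_true] using Measure.measurePreserving_swap
    · simp only [hi, if_false]
      exact MeasurePreserving.id _
  convert (h1.comp h2).comp h1.symm using 1
  funext q
  refine Prod.ext ?_ ?_ <;> funext i <;> by_cases hi : i ∈ s <;>
    simp [hi, MeasurableEquiv.arrowProdEquivProdArrow, Equiv.arrowProdEquivProdArrow]

lemma measurePreserving_piecewise (s : Finset (Fin n)) :
    MeasurePreserving (fun q : (Fin n → X) × (Fin n → X) => s.piecewise q.2 q.1)
      ((Measure.pi fun _ => P).prod (Measure.pi fun _ => P)) (Measure.pi fun _ => P) :=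
  measurePreserving_fst.comp (measurePreserving_piecewise_swap s)

lemma _root_.MeasureTheory.MeasurePreserving.integral_comp_of_measurable {β γ : Type*}
    [MeasurableSpace β] [MeasurableSpace γ] {f : β → γ} {μ : Measure β} {ν : Measure γ}
    (hf : MeasurePreserving f μ ν) {g : γ → ℝ} (hg : Measurable g) :
    ∫ b, g (f b) ∂μ = ∫ c, g c ∂ν := by
  rw [← hf.map_eq, integral_map hf.measurable.aemeasurable hg.aestronglyMeasurable]

/-- A function of the sample does not depend on the coordinates in `s`. -/
def IndepOfCoords {β : Type*} (s : Finset (Fin n)) (g : (Fin n → X) → β) : Prop :=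
  ∀ T T', g (s.piecewise T' T) = g T

/-- If `g` does not depend on the `i`-th observation, then this observation can serve as a new
one. -/
lemma integral_apply_self {s : Finset (Fin n)} {g : (Fin n → X) → X → ℝ}
    (hg : Measurable (Function.uncurry g)) (hs : IndepOfCoords s g) {i : Fin n} (hi : i ∈ s) :
    ∫ T, g T (T i) ∂(Measure.pi fun _ => P) =
      ∫ q, g q.1 q.2 ∂((Measure.pi fun _ => P).prod P) := by
  have h1 := (measurePreserving_piecewise (P := P) s).integral_comp_of_measurable
    (g := fun T => g T (T i)) (hg.comp (by fun_prop : Measurable fun T : Fin n → X => (T, T i)))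
  have h2 := ((MeasurePreserving.id (Measure.pi fun _ : Fin n => P)).prod
    (measurePreserving_eval (fun _ : Fin n => P) i)).integral_comp_of_measurable hg
  rw [← h1]
  refine Eq.trans (integral_congr_ae (ae_of_all _ fun q => ?_)) h2
  simp only [hs q.1 q.2, Finset.piecewise_eq_of_mem _ _ _ hi]
  rfl

end Resampling

/-! ### Mean square error of the cross-validation average -/

section MeanSquare

variable {X : Type*} [MeasurableSpace X] {P : Measure X} [IsProbabilityMeasure P] {n k : ℕ}
  {K : Fin k → Finset (Fin n)}

/-- The average over the fold `s` of `f T (T i)`, centred at the mean for a new observation. -/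
noncomputable def foldDeviation (P : Measure X) (s : Finset (Fin n)) (f : (Fin n → X) → X → ℝ)
    (T : Fin n → X) : ℝ :=
  (1 / (s.card : ℝ)) * ∑ i ∈ s, f T (T i) - ∫ z, f T z ∂P

lemma inv_card_mul_sum_mem_Icc {s : Finset (Fin n)} {g : Fin n → ℝ}
    (h : ∀ i, g i ∈ Set.Icc (0 : ℝ) 1) :
    (1 / (s.card : ℝ)) * ∑ i ∈ s, g i ∈ Set.Icc (0 : ℝ) 1 := by
  refine ⟨mul_nonneg (by positivity) (Finset.sum_nonneg fun i _ => (h i).1), ?_⟩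
  rcases s.eq_empty_or_nonempty with rfl | hs
  · simp
  · have hc : (0 : ℝ) < s.card := by exact_mod_cast hs.card_pos
    rw [one_div, inv_mul_le_iff₀ hc, mul_one]
    simpa using Finset.sum_le_card_nsmul s g 1 fun i _ => (h i).2

lemma integrable_of_mem_Icc {β : Type*} [MeasurableSpace β] {μ : Measure β} [IsFiniteMeasure μ]
    {g : β → ℝ} (hg : Measurable g) {a b : ℝ} (h : ∀ x, g x ∈ Set.Icc a b) : Integrable g μ :=
  Integrable.of_mem_Icc a b hg.aemeasurable (ae_of_all _ h)

lemma integral_mem_Icc {β : Type*} [MeasurableSpace β] {μ : Measure β} [IsProbabilityMeasure μ]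
    {g : β → ℝ} (h : ∀ x, g x ∈ Set.Icc (0 : ℝ) 1) : ∫ x, g x ∂μ ∈ Set.Icc (0 : ℝ) 1 := by
  refine ⟨integral_nonneg fun x => (h x).1, ?_⟩
  have := integral_mono_of_nonneg (μ := μ) (ae_of_all _ fun x => (h x).1)
    (integrable_const (1 : ℝ)) (ae_of_all _ fun x => (h x).2)
  simpa using this

variable {f : (Fin n → X) → X → ℝ}

lemma abs_foldDeviation_le_one (hf : ∀ T z, f T z ∈ Set.Icc (0 : ℝ) 1) (s : Finset (Fin n))
    (T : Fin n → X) : |foldDeviation P s f T| ≤ 1 := by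
  have h1 := inv_card_mul_sum_mem_Icc (s := s) fun i => hf T (T i)
  have h2 := integral_mem_Icc (μ := P) (hf T)
  rw [foldDeviation, abs_le]
  constructor <;> linarith [h1.1, h1.2, h2.1, h2.2]

lemma measurable_foldDeviation (hf : Measurable (Function.uncurry f)) (s : Finset (Fin n)) :
    Measurable (foldDeviation P s f) := by
  refine Measurable.sub (Measurable.const_mul (Finset.measurable_fun_sum _ fun i _ => ?_) _) ?_
  · exact hf.comp (by fun_prop : Measurable fun T : Fin n → X => (T, T i))
  · exact (hf.stronglyMeasurable.integral_prod_right (ν := P)).measurable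

/-- If `f` does not depend on the fold `s`, then the deviation has mean zero given the
observations outside `s`. -/
lemma integral_foldDeviation_piecewise (hf : Measurable (Function.uncurry f))
    (hb : ∀ T z, f T z ∈ Set.Icc (0 : ℝ) 1) {s : Finset (Fin n)} (hs : s.Nonempty)
    (hfs : IndepOfCoords s f) (T : Fin n → X) :
    ∫ T', foldDeviation P s f (s.piecewise T' T) ∂(Measure.pi fun _ => P) = 0 := by
  have hfT : Measurable (f T) := hf.comp measurable_prodMk_left
  have h1 : ∀ T', foldDeviation P s f (s.piecewise T' T) =
      (1 / (s.card : ℝ)) * ∑ i ∈ s, f T (T' i) - ∫ z, f T z ∂P := fun T' => by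
    rw [foldDeviation, hfs T T']
    congr 2
    exact Finset.sum_congr rfl fun i hi => by simp [hi]
  have hint (i : Fin n) : Integrable (fun T' : Fin n → X => f T (T' i))
      (Measure.pi fun _ => P) :=
    integrable_of_mem_Icc (hfT.comp (measurable_pi_apply i)) fun T' => hb T _
  have hc : (s.card : ℝ) ≠ 0 := by exact_mod_cast hs.card_pos.ne'
  simp only [h1]
  rw [integral_sub ((integrable_finsetSum _ fun i _ => hint i).const_mul _) (integrable_const _),
    integral_const_mul, integral_finsetSum _ fun i _ => hint i]
  have h2 (i : Fin n) : ∫ T', f T (T' i) ∂(Measure.pi fun _ : Fin n => P) = ∫ z, f T z ∂P :=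
    (measurePreserving_eval (fun _ : Fin n => P) i).integral_comp_of_measurable hfT
  simp only [h2, Finset.sum_const, nsmul_eq_mul, integral_const, probReal_univ, one_smul]
  field_simp
  simp

/-- A function that is `L¹`-close to one that does not depend on `s` changes little in `L¹` when
the observations in `s` are resampled. -/
lemma integral_abs_sub_piecewise_le {g : (Fin n → X) → X → ℝ}
    (hf : Measurable (Function.uncurry f)) (hg : Measurable (Function.uncurry g))
    (hfb : ∀ T z, f T z ∈ Set.Icc (0 : ℝ) 1) (hgb : ∀ T z, g T z ∈ Set.Icc (0 : ℝ) 1)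
    {s : Finset (Fin n)} (hgs : IndepOfCoords s g) :
    ∫ q, |f q.1.1 q.2 - f (s.piecewise q.1.2 q.1.1) q.2|
      ∂(((Measure.pi fun _ => P).prod (Measure.pi fun _ => P)).prod P) ≤
      2 * ∫ q, |f q.1 q.2 - g q.1 q.2| ∂((Measure.pi fun _ => P).prod P) := by
  set π := (Measure.pi fun _ : Fin n => P) with hπ
  have hD : Measurable fun q : (Fin n → X) × X => |f q.1 q.2 - g q.1 q.2| := (hf.sub hg).abs
  have p1 : MeasurePreserving (fun q : ((Fin n → X) × (Fin n → X)) × X => (q.1.1, q.2))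
      ((π.prod π).prod P) (π.prod P) :=
    (measurePreserving_fst (μ := π) (ν := π)).prod (MeasurePreserving.id P)
  have p2 : MeasurePreserving (fun q : ((Fin n → X) × (Fin n → X)) × X =>
      (s.piecewise q.1.2 q.1.1, q.2)) ((π.prod π).prod P) (π.prod P) :=
    (measurePreserving_piecewise (P := P) s).prod (MeasurePreserving.id P)
  have e1 : ∫ q, |f q.1.1 q.2 - g q.1.1 q.2| ∂((π.prod π).prod P) = _ :=
    p1.integral_comp_of_measurable hD
  have e2 : ∫ q, |f (s.piecewise q.1.2 q.1.1) q.2 - g (s.piecewise q.1.2 q.1.1) q.2|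
      ∂((π.prod π).prod P) = _ := p2.integral_comp_of_measurable hD
  have b (q : (Fin n → X) × X) : |f q.1 q.2 - g q.1 q.2| ∈ Set.Icc (0 : ℝ) 1 := by
    have h1 := hfb q.1 q.2
    have h2 := hgb q.1 q.2
    exact ⟨abs_nonneg _, abs_le.2 ⟨by linarith [h1.1, h2.2], by linarith [h1.2, h2.1]⟩⟩
  have i1 : Integrable (fun q : ((Fin n → X) × (Fin n → X)) × X =>
      |f q.1.1 q.2 - g q.1.1 q.2|) ((π.prod π).prod P) :=
    integrable_of_mem_Icc (hD.comp p1.measurable) fun q => b (q.1.1, q.2)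
  have i2 : Integrable (fun q : ((Fin n → X) × (Fin n → X)) × X =>
      |f (s.piecewise q.1.2 q.1.1) q.2 - g (s.piecewise q.1.2 q.1.1) q.2|) ((π.prod π).prod P) :=
    integrable_of_mem_Icc (hD.comp p2.measurable) fun q => b (s.piecewise q.1.2 q.1.1, q.2)
  rw [two_mul]
  nth_rewrite 1 [← e1]
  rw [← e2, ← integral_add i1 i2]
  refine integral_mono_of_nonneg (ae_of_all _ fun q => abs_nonneg _) (i1.add i2)
    (ae_of_all _ fun q => ?_)
  have h := congrFun (hgs q.1.1 q.1.2) q.2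
  have h3 := abs_sub_le (f q.1.1 q.2) (g q.1.1 q.2) (f (s.piecewise q.1.2 q.1.1) q.2)
  rw [abs_sub_comm (g q.1.1 q.2)] at h3
  simpa only [Function.comp, Pi.add_apply, h] using h3

/-- Resampling the observations in a set `s` disjoint from the fold `t` changes the deviation of
the fold `t` little in `L¹`. -/
lemma integral_abs_foldDeviation_sub_le {g : (Fin n → X) → X → ℝ}
    (hf : Measurable (Function.uncurry f)) (hg : Measurable (Function.uncurry g))
    (hfb : ∀ T z, f T z ∈ Set.Icc (0 : ℝ) 1) (hgb : ∀ T z, g T z ∈ Set.Icc (0 : ℝ) 1)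
    {s t : Finset (Fin n)} (hst : Disjoint s t) (hgs : IndepOfCoords s g)
    (hft : IndepOfCoords t f) :
    ∫ q, |foldDeviation P t f q.1 - foldDeviation P t f (s.piecewise q.2 q.1)|
      ∂((Measure.pi fun _ => P).prod (Measure.pi fun _ => P)) ≤
      4 * ∫ q, |f q.1 q.2 - g q.1 q.2| ∂((Measure.pi fun _ => P).prod P) := by
  set π := (Measure.pi fun _ : Fin n => P) with hπ
  set h : ((Fin n → X) × (Fin n → X)) × X → ℝ :=
    fun q => |f q.1.1 q.2 - f (s.piecewise q.1.2 q.1.1) q.2| with hh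
  have hpw : Measurable fun q : (Fin n → X) × (Fin n → X) => s.piecewise q.2 q.1 :=
    (measurePreserving_piecewise (P := P) s).measurable
  have hhm : Measurable h :=
    ((hf.comp (by fun_prop : Measurable fun q : ((Fin n → X) × (Fin n → X)) × X =>
      (q.1.1, q.2))).sub (hf.comp ((hpw.comp measurable_fst).prodMk measurable_snd))).abs
  have hhb (q) : h q ∈ Set.Icc (0 : ℝ) 1 := by
    have h1 := hfb q.1.1 q.2
    have h2 := hfb (s.piecewise q.1.2 q.1.1) q.2
    exact ⟨abs_nonneg _, abs_le.2 ⟨by linarith [h1.1, h2.2], by linarith [h1.2, h2.1]⟩⟩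
  have hI : ∫ q, h q ∂((π.prod π).prod P) ≤
      2 * ∫ q, |f q.1 q.2 - g q.1 q.2| ∂(π.prod P) :=
    integral_abs_sub_piecewise_le hf hg hfb hgb hgs
  -- the observations in `t` are new observations for `h`
  have hdiag (i : Fin n) (hi : i ∈ t) :
      ∫ q, h (q, q.1 i) ∂(π.prod π) = ∫ q, h q ∂((π.prod π).prod P) := by
    have hm2 : Measurable fun q : (Fin n → X) × (Fin n → X) => h (q, q.1 i) :=
      hhm.comp (by fun_prop)
    rw [integral_prod_symm _ (integrable_of_mem_Icc hm2 fun q => hhb _),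
      integral_prod _ (integrable_of_mem_Icc hhm hhb), integral_prod_symm]
    · refine integral_congr_ae (ae_of_all _ fun T' => ?_)
      have hmT' : Measurable (Function.uncurry fun T z => h ((T, T'), z)) :=
        hhm.comp (by fun_prop : Measurable fun q : (Fin n → X) × X => ((q.1, T'), q.2))
      have := integral_apply_self (P := P) (g := fun T z => h ((T, T'), z)) hmT' (s := t)
        (fun T T'' => by
          funext z
          have hcomm : s.piecewise T' (t.piecewise T'' T) = t.piecewise T'' (s.piecewise T' T) := by
            funext j
            by_cases hjs : j ∈ s
            · have hjt : j ∉ t := Finset.disjoint_left.1 hst hjs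
              simp [hjs, hjt]
            · by_cases hjt : j ∈ t <;> simp [hjs, hjt]
          simp only [hh, hcomm, hft _ T'']) hi
      refine this.trans ?_
      exact integral_prod (fun q : (Fin n → X) × X => h ((q.1, T'), q.2))
        (integrable_of_mem_Icc hmT' fun q => hhb _)
    · exact (integrable_of_mem_Icc hhm hhb).integral_prod_left
  have hidiag (i : Fin n) : Integrable (fun q : (Fin n → X) × (Fin n → X) => h (q, q.1 i))
      (π.prod π) := integrable_of_mem_Icc (hhm.comp (by fun_prop)) fun q => hhb _
  have hiint : Integrable (fun q => ∫ z, h (q, z) ∂P) (π.prod π) :=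
    (integrable_of_mem_Icc hhm hhb).integral_prod_left
  have hpt (q : (Fin n → X) × (Fin n → X)) :
      |foldDeviation P t f q.1 - foldDeviation P t f (s.piecewise q.2 q.1)| ≤
        (1 / (t.card : ℝ)) * ∑ i ∈ t, h (q, q.1 i) + ∫ z, h (q, z) ∂P := by
    have hfi (T) : Integrable (f T) P :=
      integrable_of_mem_Icc (hf.comp measurable_prodMk_left) (hfb T)
    have e : foldDeviation P t f q.1 - foldDeviation P t f (s.piecewise q.2 q.1) =
        (1 / (t.card : ℝ)) * ∑ i ∈ t, (f q.1 (q.1 i) - f (s.piecewise q.2 q.1) (q.1 i)) -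
          ∫ z, (f q.1 z - f (s.piecewise q.2 q.1) z) ∂P := by
      have : ∑ i ∈ t, f (s.piecewise q.2 q.1) (s.piecewise q.2 q.1 i) =
          ∑ i ∈ t, f (s.piecewise q.2 q.1) (q.1 i) :=
        Finset.sum_congr rfl fun i hi => by
          rw [Finset.piecewise_eq_of_notMem _ _ _ (Finset.disjoint_right.1 hst hi)]
      rw [integral_sub (hfi _) (hfi _), Finset.sum_sub_distrib, foldDeviation, foldDeviation, this]
      ring
    rw [e]
    refine (abs_sub _ _).trans (add_le_add ?_ abs_integral_le_integral_abs)
    rw [abs_mul, abs_of_nonneg (by positivity : (0 : ℝ) ≤ 1 / (t.card : ℝ))]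
    gcongr
    exact Finset.abs_sum_le_sum_abs _ _
  have hsum : (1 / (t.card : ℝ)) * ∑ i ∈ t, ∫ q, h (q, q.1 i) ∂(π.prod π) ≤
      ∫ q, h q ∂((π.prod π).prod P) := by
    rw [Finset.sum_congr rfl hdiag, Finset.sum_const, nsmul_eq_mul]
    have h0 : 0 ≤ ∫ q, h q ∂((π.prod π).prod P) := integral_nonneg fun q => (hhb q).1
    rcases t.eq_empty_or_nonempty with rfl | ht
    · simpa using h0
    · have : (t.card : ℝ) ≠ 0 := by exact_mod_cast ht.card_pos.ne'
      field_simp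
      exact le_rfl
  have hI2 := integral_mono_of_nonneg (ae_of_all _ fun q => abs_nonneg _)
    (((integrable_finsetSum t fun i _ => hidiag i).const_mul (1 / (t.card : ℝ))).add hiint)
    (ae_of_all (π.prod π) hpt)
  simp only [Pi.add_apply] at hI2
  rw [integral_add ((integrable_finsetSum t fun i _ => hidiag i).const_mul _) hiint,
    integral_const_mul, integral_finsetSum _ fun i _ => hidiag i,
    ← integral_prod _ (integrable_of_mem_Icc hhm hhb)] at hI2
  linarith

/-- The deviations of two disjoint folds are nearly uncorrelated: resampling one fold hardly
changes the deviation of the other one, and makes the covariance vanish. -/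
lemma integral_foldDeviation_mul_le {g : (Fin n → X) → X → ℝ}
    (hf : Measurable (Function.uncurry f)) (hg : Measurable (Function.uncurry g))
    (hfb : ∀ T z, f T z ∈ Set.Icc (0 : ℝ) 1) (hgb : ∀ T z, g T z ∈ Set.Icc (0 : ℝ) 1)
    {s t : Finset (Fin n)} (hst : Disjoint s t) (hsne : s.Nonempty) (hgs : IndepOfCoords s g)
    (hft : IndepOfCoords t f) :
    ∫ T, foldDeviation P s g T * foldDeviation P t f T ∂(Measure.pi fun _ => P) ≤
      4 * ∫ q, |f q.1 q.2 - g q.1 q.2| ∂((Measure.pi fun _ => P).prod P) := by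
  set π := (Measure.pi fun _ : Fin n => P) with hπ
  set U := foldDeviation P s g with hU
  set W := foldDeviation P t f with hW
  have hUm : Measurable U := measurable_foldDeviation hg s
  have hWm : Measurable W := measurable_foldDeviation hf t
  have hUb (T) : |U T| ≤ 1 := abs_foldDeviation_le_one hgb s T
  have hWb (T) : |W T| ≤ 1 := abs_foldDeviation_le_one hfb t T
  have hsw := measurePreserving_piecewise_swap (P := P) s
  have hpw : Measurable fun q : (Fin n → X) × (Fin n → X) => s.piecewise q.2 q.1 :=
    (measurePreserving_piecewise (P := P) s).measurable
  have hbd (a b : ℝ) (ha : |a| ≤ 1) (hb : |b| ≤ 1) : a * b ∈ Set.Icc (-1 : ℝ) 1 := by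
    rw [Set.mem_Icc, ← abs_le, abs_mul]
    exact mul_le_one₀ ha (abs_nonneg _) hb
  have m1 : Measurable fun q : (Fin n → X) × (Fin n → X) => U q.1 * W q.1 :=
    (hUm.comp measurable_fst).mul (hWm.comp measurable_fst)
  have m2 : Measurable fun q : (Fin n → X) × (Fin n → X) => U q.1 * W (s.piecewise q.2 q.1) :=
    (hUm.comp measurable_fst).mul (hWm.comp hpw)
  have m3 : Measurable fun q : (Fin n → X) × (Fin n → X) => U (s.piecewise q.2 q.1) * W q.1 :=
    (hUm.comp hpw).mul (hWm.comp measurable_fst)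
  have i1 := integrable_of_mem_Icc (μ := π.prod π) m1 fun q => hbd _ _ (hUb _) (hWb _)
  have i2 := integrable_of_mem_Icc (μ := π.prod π) m2 fun q => hbd _ _ (hUb _) (hWb _)
  have i3 := integrable_of_mem_Icc (μ := π.prod π) m3 fun q => hbd _ _ (hUb _) (hWb _)
  have e1 : ∫ T, U T * W T ∂π = ∫ q, U q.1 * W q.1 ∂(π.prod π) :=
    ((measurePreserving_fst (μ := π) (ν := π)).integral_comp_of_measurable (hUm.mul hWm)).symm
  have e2 : ∫ q, U q.1 * W (s.piecewise q.2 q.1) ∂(π.prod π) = 0 := by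
    -- exchanging the fold `s` moves the resampling from `W` to the centred factor `U`
    rw [← hsw.integral_comp_of_measurable m2]
    have hpp (q : (Fin n → X) × (Fin n → X)) :
        s.piecewise (s.piecewise q.1 q.2) (s.piecewise q.2 q.1) = q.1 := by
      funext i
      by_cases hi : i ∈ s <;> simp [hi]
    simp only [hpp]
    rw [integral_prod _ i3]
    simp only [integral_mul_const, hU, integral_foldDeviation_piecewise hg hgb hsne hgs, hπ,
      zero_mul, integral_zero]
  have m4 : Measurable fun q : (Fin n → X) × (Fin n → X) => |W q.1 - W (s.piecewise q.2 q.1)| :=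
    ((hWm.comp measurable_fst).sub (hWm.comp hpw)).abs
  have i4 := integrable_of_mem_Icc (μ := π.prod π) (a := 0) (b := 2) m4 fun q =>
    ⟨abs_nonneg _, (abs_sub _ _).trans (by linarith [hWb q.1, hWb (s.piecewise q.2 q.1)])⟩
  have h4 : ∫ q, |W q.1 - W (s.piecewise q.2 q.1)| ∂(π.prod π) ≤ _ :=
    integral_abs_foldDeviation_sub_le hf hg hfb hgb hst hgs hft
  have h5 : ∫ q, (U q.1 * W q.1 - U q.1 * W (s.piecewise q.2 q.1)) ∂(π.prod π) ≤
      ∫ q, |W q.1 - W (s.piecewise q.2 q.1)| ∂(π.prod π) := by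
    refine integral_mono (i1.sub i2) i4 fun q => ?_
    dsimp only
    rw [← mul_sub]
    refine (le_abs_self _).trans ?_
    rw [abs_mul]
    exact mul_le_of_le_one_left (abs_nonneg _) (hUb _)
  rw [integral_sub i1 i2, e2, sub_zero, ← e1] at h5
  exact h5.trans h4

end MeanSquare

section MeanSquareAverage

variable {X : Type*} [MeasurableSpace X] {P : Measure X} [IsProbabilityMeasure P] {n k : ℕ}
  {K : Fin k → Finset (Fin n)} {f : Fin k → (Fin n → X) → X → ℝ} {f₀ : (Fin n → X) → X → ℝ}

lemma integrable_abs_sub {f g : (Fin n → X) → X → ℝ} (hf : Measurable (Function.uncurry f))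
    (hg : Measurable (Function.uncurry g)) (hfb : ∀ T z, f T z ∈ Set.Icc (0 : ℝ) 1)
    (hgb : ∀ T z, g T z ∈ Set.Icc (0 : ℝ) 1) :
    Integrable (fun q : (Fin n → X) × X => |f q.1 q.2 - g q.1 q.2|)
      ((Measure.pi fun _ => P).prod P) := by
  refine integrable_of_mem_Icc (a := 0) (b := 1) (hf.sub hg).abs fun q => ?_
  have h1 := hfb q.1 q.2
  have h2 := hgb q.1 q.2
  exact ⟨abs_nonneg _, abs_le.2 ⟨by linarith [h1.1, h2.2], by linarith [h1.2, h2.1]⟩⟩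

/-- The mean square of the cross-validation deviation. The diagonal terms contribute `1 / k`, the
covariances are controlled by the instability of `f`. -/
lemma integral_sq_avg_foldDeviation_le (hK : IsFoldPartition K) (hk : 0 < k)
    (hf : ∀ j, Measurable (Function.uncurry (f j))) (hf₀ : Measurable (Function.uncurry f₀))
    (hb : ∀ j T z, f j T z ∈ Set.Icc (0 : ℝ) 1) (hb₀ : ∀ T z, f₀ T z ∈ Set.Icc (0 : ℝ) 1)
    (hi : ∀ j, IndepOfCoords (K j) (f j)) :
    ∫ T, ((1 / (k : ℝ)) * ∑ j, foldDeviation P (K j) (f j) T) ^ 2 ∂(Measure.pi fun _ => P) ≤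
      1 / (k : ℝ) + 8 * ((1 / (k : ℝ)) * ∑ j,
        ∫ q, |f j q.1 q.2 - f₀ q.1 q.2| ∂((Measure.pi fun _ => P).prod P)) := by
  set π := (Measure.pi fun _ : Fin n => P) with hπ
  set W := fun j => foldDeviation P (K j) (f j) with hW
  set ρ := fun j => ∫ q, |f j q.1 q.2 - f₀ q.1 q.2| ∂(π.prod P) with hρ
  have hWm (j) : Measurable (W j) := measurable_foldDeviation (hf j) (K j)
  have hWb (j T) : |W j T| ≤ 1 := abs_foldDeviation_le_one (hb j) (K j) T
  have hbd (j l T) : W j T * W l T ∈ Set.Icc (-1 : ℝ) 1 := by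
    rw [Set.mem_Icc, ← abs_le, abs_mul]
    exact mul_le_one₀ (hWb j T) (abs_nonneg _) (hWb l T)
  have hint (j l) : Integrable (fun T => W j T * W l T) π :=
    integrable_of_mem_Icc ((hWm j).mul (hWm l)) (hbd j l)
  have hρ0 (j) : 0 ≤ ρ j := integral_nonneg fun q => abs_nonneg _
  have hcross (j l) : ∫ T, W j T * W l T ∂π ≤ (if j = l then 1 else 0) + 4 * (ρ j + ρ l) := by
    by_cases hjl : j = l
    · have h1 : ∫ T, W j T * W l T ∂π ≤ 1 := by
        have := integral_mono (hint j l) (integrable_const (μ := π) (1 : ℝ))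
          fun T => (hbd j l T).2
        simpa using this
      simp only [hjl, if_true] at h1 ⊢
      linarith [hρ0 l]
    · simp only [hjl, if_false, zero_add]
      refine (integral_foldDeviation_mul_le (hf l) (hf j) (hb l) (hb j) (hK.disjoint j l hjl)
        (hK.nonempty j) (hi j) (hi l)).trans ?_
      have : ∫ q, |f l q.1 q.2 - f j q.1 q.2| ∂(π.prod P) ≤ ρ l + ρ j := by
        rw [hρ]
        dsimp only
        rw [← integral_add (integrable_abs_sub (hf l) hf₀ (hb l) hb₀)
          (integrable_abs_sub (hf j) hf₀ (hb j) hb₀)]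
        refine integral_mono (integrable_abs_sub (hf l) (hf j) (hb l) (hb j))
          ((integrable_abs_sub (hf l) hf₀ (hb l) hb₀).add
            (integrable_abs_sub (hf j) hf₀ (hb j) hb₀)) fun q => ?_
        have := abs_sub_le (f l q.1 q.2) (f₀ q.1 q.2) (f j q.1 q.2)
        rwa [abs_sub_comm (f₀ q.1 q.2)] at this
      linarith
  have hsq : ∀ T, ((1 / (k : ℝ)) * ∑ j, W j T) ^ 2 =
      (1 / (k : ℝ)) ^ 2 * ∑ j, ∑ l, W j T * W l T := fun T => by
    rw [mul_pow, sq (∑ j, W j T), Finset.sum_mul_sum]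
  have hk' : (k : ℝ) ≠ 0 := by exact_mod_cast hk.ne'
  calc ∫ T, ((1 / (k : ℝ)) * ∑ j, W j T) ^ 2 ∂π
      = (1 / (k : ℝ)) ^ 2 * ∑ j, ∑ l, ∫ T, W j T * W l T ∂π := by
        simp only [hsq]
        rw [integral_const_mul, integral_finsetSum _ fun j _ => integrable_finsetSum _
          fun l _ => hint j l]
        congr 1
        exact Finset.sum_congr rfl fun j _ => integral_finsetSum _ fun l _ => hint j l
    _ ≤ (1 / (k : ℝ)) ^ 2 * ∑ j : Fin k, ∑ l : Fin k,
          ((if j = l then 1 else 0) + 4 * (ρ j + ρ l)) := by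
        gcongr with j _ l _
        exact hcross j l
    _ = 1 / (k : ℝ) + 8 * ((1 / (k : ℝ)) * ∑ j, ρ j) := by
        simp only [Finset.sum_add_distrib, ← Finset.mul_sum, Finset.sum_ite_eq, Finset.mem_univ,
          if_true, Finset.sum_const, Finset.card_univ, Fintype.card_fin, nsmul_eq_mul]
        field_simp
        ring

/-- The cross-validation average estimates the conditional mean of `f₀` given the training data
in `L¹`. -/
lemma integral_abs_foldAvg_sub_le (hK : IsFoldPartition K) (hk : 0 < k)
    (hf : ∀ j, Measurable (Function.uncurry (f j))) (hf₀ : Measurable (Function.uncurry f₀))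
    (hb : ∀ j T z, f j T z ∈ Set.Icc (0 : ℝ) 1) (hb₀ : ∀ T z, f₀ T z ∈ Set.Icc (0 : ℝ) 1)
    (hi : ∀ j, IndepOfCoords (K j) (f j)) {c r : ℝ} (hc : 0 < c)
    (hr : (1 / (k : ℝ)) * ∑ j,
        ∫ q, |f j q.1 q.2 - f₀ q.1 q.2| ∂((Measure.pi fun _ => P).prod P) ≤ r) :
    ∫ T, |foldAvg K (fun j i => f j T (T i)) - ∫ z, f₀ T z ∂P| ∂(Measure.pi fun _ => P) ≤
      c + (1 / (k : ℝ) + 8 * r) / c + r := by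
  set π := (Measure.pi fun _ : Fin n => P) with hπ
  set D := fun T => (1 / (k : ℝ)) * ∑ j, foldDeviation P (K j) (f j) T with hD
  have hDm : Measurable D := Measurable.const_mul
    (Finset.measurable_fun_sum _ fun j _ => measurable_foldDeviation (hf j) (K j)) _
  have hk' : (0 : ℝ) < k := by exact_mod_cast hk
  have hDb (T) : |D T| ≤ 1 := by
    rw [hD, abs_mul, abs_of_pos (by positivity), one_div, inv_mul_le_iff₀ hk', mul_one]
    refine (Finset.abs_sum_le_sum_abs _ _).trans ?_
    simpa using Finset.sum_le_card_nsmul Finset.univ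
      (fun j => |foldDeviation P (K j) (f j) T|) 1
      fun j _ => abs_foldDeviation_le_one (hb j) (K j) T
  have hD2 : ∫ T, D T ^ 2 ∂π ≤ 1 / (k : ℝ) + 8 * r :=
    (integral_sq_avg_foldDeviation_le hK hk hf hf₀ hb hb₀ hi).trans (by gcongr)
  have hD2i : Integrable (fun T => D T ^ 2) π :=
    integrable_of_mem_Icc (a := 0) (b := 1) (hDm.pow_const 2) fun T =>
      ⟨sq_nonneg _, (sq_le_one_iff_abs_le_one _).2 (hDb T)⟩
  set B := fun j T => ∫ z, |f j T z - f₀ T z| ∂P with hB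
  have hBi (j) : Integrable (B j) π :=
    (integrable_abs_sub (hf j) hf₀ (hb j) hb₀).integral_prod_left
  have hBint (j) : ∫ T, B j T ∂π = ∫ q, |f j q.1 q.2 - f₀ q.1 q.2| ∂(π.prod P) :=
    (integral_prod _ (integrable_abs_sub (hf j) hf₀ (hb j) hb₀)).symm
  have hpt (T) : |foldAvg K (fun j i => f j T (T i)) - ∫ z, f₀ T z ∂P| ≤
      (c + D T ^ 2 / c) + (1 / (k : ℝ)) * ∑ j, B j T := by
    have hfi (j) : Integrable (f j T) P :=
      integrable_of_mem_Icc ((hf j).comp measurable_prodMk_left) (hb j T)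
    have hfi₀ : Integrable (f₀ T) P :=
      integrable_of_mem_Icc (hf₀.comp measurable_prodMk_left) (hb₀ T)
    have e : foldAvg K (fun j i => f j T (T i)) - ∫ z, f₀ T z ∂P =
        D T + (1 / (k : ℝ)) * ∑ j, ∫ z, (f j T z - f₀ T z) ∂P := by
      have h1 (j) : ∫ z, (f j T z - f₀ T z) ∂P = ∫ z, f j T z ∂P - ∫ z, f₀ T z ∂P :=
        integral_sub (hfi j) hfi₀
      simp only [h1, hD, foldAvg, foldDeviation, Finset.sum_sub_distrib, Finset.sum_const,
        Finset.card_univ, Fintype.card_fin, nsmul_eq_mul]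
      field_simp
      ring
    rw [e]
    refine (abs_add_le _ _).trans (add_le_add ?_ ?_)
    · -- a substitute for the Cauchy-Schwarz inequality
      have h2 : |D T| * c ≤ c * c + D T ^ 2 := by
        rw [← sq_abs (D T)]
        nlinarith [sq_nonneg (|D T| - c), abs_nonneg (D T)]
      rw [← sub_nonneg] at h2 ⊢
      have h3 : c + D T ^ 2 / c - |D T| = (c * c + D T ^ 2 - |D T| * c) / c := by field_simp
      rw [h3]
      positivity
    · rw [abs_mul, abs_of_pos (by positivity : (0 : ℝ) < 1 / k)]
      gcongr
      refine (Finset.abs_sum_le_sum_abs _ _).trans ?_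
      gcongr with j _
      exact abs_integral_le_integral_abs
  have hI2 : Integrable (fun T => (1 / (k : ℝ)) * ∑ j, B j T) π :=
    (integrable_finsetSum _ fun j _ => hBi j).const_mul _
  have hI1 : Integrable (fun T => c + D T ^ 2 / c) π := (integrable_const c).add (hD2i.div_const c)
  refine (integral_mono_of_nonneg (ae_of_all _ fun T => abs_nonneg _) (hI1.add hI2)
    (ae_of_all _ hpt)).trans ?_
  simp only [Pi.add_apply]
  rw [integral_add hI1 hI2, integral_add (integrable_const c) (hD2i.div_const c),
    integral_div, integral_const_mul, integral_finsetSum _ fun j _ => hBi j]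
  simp only [hBint, integral_const, probReal_univ, one_smul]
  gcongr

end MeanSquareAverage

/-! ### Lévy distance from finitely many test functions -/

section Levy

/-- The continuous function that is `1` up to `s`, `0` from `s + δ` on, and linear between. -/
noncomputable def ramp (δ s u : ℝ) : ℝ := max 0 (min 1 (1 - (u - s) / δ))

lemma ramp_mem_Icc (δ s u : ℝ) : ramp δ s u ∈ Set.Icc (0 : ℝ) 1 :=
  ⟨le_max_left _ _, max_le zero_le_one (min_le_left _ _)⟩

lemma measurable_ramp (δ s : ℝ) : Measurable (ramp δ s) := by
  unfold ramp
  fun_prop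

lemma ramp_eq_one {δ s u : ℝ} (hδ : 0 < δ) (h : u ≤ s) : ramp δ s u = 1 := by
  have : (u - s) / δ ≤ 0 := div_nonpos_of_nonpos_of_nonneg (by linarith) hδ.le
  rw [ramp, min_eq_left (by linarith), max_eq_right zero_le_one]

lemma ramp_eq_zero {δ s u : ℝ} (hδ : 0 < δ) (h : s + δ ≤ u) : ramp δ s u = 0 := by
  have : 1 ≤ (u - s) / δ := by rw [one_le_div hδ]; linarith
  rw [ramp, min_eq_right (by linarith), max_eq_left (by linarith)]

lemma abs_ramp_sub_le {δ : ℝ} (hδ : 0 < δ) (s u v : ℝ) :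
    |ramp δ s u - ramp δ s v| ≤ (1 / δ) * |u - v| := by
  have h : (1 - (u - s) / δ) - (1 - (v - s) / δ) = (1 / δ) * (v - u) := by ring
  calc |ramp δ s u - ramp δ s v|
      ≤ max |0 - 0| |min 1 (1 - (u - s) / δ) - min 1 (1 - (v - s) / δ)| :=
        abs_max_sub_max_le_max _ _ _ _
    _ ≤ |(1 - (u - s) / δ) - (1 - (v - s) / δ)| :=
        max_le (by simp) ((abs_min_sub_min_le_max _ _ _ _).trans (max_le (by simp) le_rfl))
    _ = (1 / δ) * |u - v| := by
        rw [h, abs_mul, abs_of_pos (by positivity), abs_sub_comm]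

variable {n k : ℕ} {K : Fin k → Finset (Fin n)} {ν : Measure ℝ}

lemma measureReal_Iic_eq_integral (s : ℝ) :
    ν.real (Set.Iic s) = ∫ u, (if u ≤ s then (1 : ℝ) else 0) ∂ν := by
  rw [← integral_indicator_one measurableSet_Iic]
  simp [Set.indicator_apply]

variable [IsProbabilityMeasure ν]

lemma indicator_le_ramp {δ : ℝ} (hδ : 0 < δ) (s u : ℝ) :
    (if u ≤ s then 1 else 0) ≤ ramp δ s u := by
  split_ifs with h
  · rw [ramp_eq_one hδ h]
  · exact (ramp_mem_Icc δ s u).1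

lemma ramp_le_indicator {δ : ℝ} (hδ : 0 < δ) (s u : ℝ) :
    ramp δ s u ≤ if u ≤ s + δ then 1 else 0 := by
  split_ifs with h
  · exact (ramp_mem_Icc δ s u).2
  · rw [ramp_eq_zero hδ (not_le.1 h).le]

lemma integrable_ramp (δ s : ℝ) : Integrable (ramp δ s) ν :=
  integrable_of_mem_Icc (measurable_ramp δ s) (ramp_mem_Icc δ s)

lemma integrable_indicator_le (s : ℝ) :
    Integrable (fun u => if u ≤ s then (1 : ℝ) else 0) ν :=
  integrable_of_mem_Icc (a := 0) (b := 1)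
    (Measurable.ite measurableSet_Iic measurable_const measurable_const)
    fun u => by split_ifs <;> simp

lemma measureReal_Iic_le_integral_ramp {δ : ℝ} (hδ : 0 < δ) (s : ℝ) :
    ν.real (Set.Iic s) ≤ ∫ u, ramp δ s u ∂ν := by
  rw [measureReal_Iic_eq_integral]
  exact integral_mono (integrable_indicator_le s) (integrable_ramp δ s) (indicator_le_ramp hδ s)

lemma integral_ramp_le_measureReal_Iic {δ : ℝ} (hδ : 0 < δ) (s : ℝ) :
    ∫ u, ramp δ s u ∂ν ≤ ν.real (Set.Iic (s + δ)) := by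
  rw [measureReal_Iic_eq_integral]
  exact integral_mono (integrable_ramp δ s) (integrable_indicator_le _) (ramp_le_indicator hδ s)

/-- Agreement of the averages of the ramps located in a finite net, together with a small tail of
`ν`, bounds the Lévy distance between the fold-weighted distribution of `u` and `ν`. -/
lemma levy_of_ramps (hK : IsFoldPartition K) {δ M : ℝ} (hδ : 0 < δ) (hM : 0 ≤ M)
    {S : Finset ℝ} (hS : ∀ r, |r| ≤ M + 5 * δ → ∃ s ∈ S, |s - r| ≤ δ / 2)
    (u : Fin k → Fin n → ℝ) {ψ : ℝ}
    (hψ : ∑ s ∈ S, |foldAvg K (fun j i => ramp δ s (u j i)) - ∫ x, ramp δ s x ∂ν| +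
      ν.real {x | M < |x|} ≤ ψ) (t : ℝ) :
    foldCdf K u t ≤ ν.real (Set.Iic (t + 2 * δ)) + ψ ∧
      ν.real (Set.Iic (t - 2 * δ)) ≤ foldCdf K u t + ψ := by
  set D := ∑ s ∈ S, |foldAvg K (fun j i => ramp δ s (u j i)) - ∫ x, ramp δ s x ∂ν| with hD
  set τ := ν.real {x | M < |x|} with hτ
  have hD0 : 0 ≤ D := Finset.sum_nonneg fun _ _ => abs_nonneg _
  have hτ0 : 0 ≤ τ := measureReal_nonneg
  have hDs (s) (hs : s ∈ S) :
      |foldAvg K (fun j i => ramp δ s (u j i)) - ∫ x, ramp δ s x ∂ν| ≤ D :=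
    Finset.single_le_sum (f := fun s => |foldAvg K (fun j i => ramp δ s (u j i)) -
      ∫ x, ramp δ s x ∂ν|) (fun _ _ => abs_nonneg _) hs
  have hFmono : Monotone fun t => ν.real (Set.Iic t) := fun a b hab =>
    measureReal_mono (Set.Iic_subset_Iic.2 hab)
  have htailL (t : ℝ) (ht : t < -M) : ν.real (Set.Iic t) ≤ τ :=
    measureReal_mono fun x hx => by
      have : x ≤ t := hx
      rw [Set.mem_ofPred_eq, lt_abs]
      right
      linarith
  have htailR (t : ℝ) (ht : M ≤ t) : 1 ≤ ν.real (Set.Iic t) + τ := by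
    rw [← probReal_univ (μ := ν)]
    refine (measureReal_mono fun x _ => ?_).trans (measureReal_union_le _ _)
    rcases le_or_gt x t with h | h
    · exact Or.inl h
    · right
      rw [Set.mem_ofPred_eq, lt_abs]
      left
      linarith
  -- in each case a point `s` of the net is taken such that the ramp from `s` to `s + δ` separates
  -- the two thresholds that are compared
  have core1 (t : ℝ) (h1 : -M - 3 * δ ≤ t) (h2 : t ≤ M + 3 * δ) :
      foldCdf K u t ≤ ν.real (Set.Iic (t + 2 * δ)) + D := by
    obtain ⟨s, hs, hst⟩ := hS (t + δ / 2) (abs_le.2 ⟨by linarith, by linarith⟩)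
    rw [abs_le] at hst
    have a1 := foldCdf_mono K u (show t ≤ s by linarith)
    have a2 : foldCdf K u s ≤ foldAvg K (fun j i => ramp δ s (u j i)) :=
      foldAvg_mono fun j i _ => indicator_le_ramp hδ s _
    have a3 := (abs_le.1 (hDs s hs)).2
    have a4 := integral_ramp_le_measureReal_Iic (ν := ν) hδ s
    have a5 := hFmono (show s + δ ≤ t + 2 * δ by linarith)
    dsimp only at a5
    linarith
  have core2 (t : ℝ) (h1 : -M - 3 * δ ≤ t) (h2 : t ≤ M + 3 * δ) :
      ν.real (Set.Iic (t - 2 * δ)) ≤ foldCdf K u t + D := by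
    obtain ⟨s, hs, hst⟩ := hS (t - 3 / 2 * δ) (abs_le.2 ⟨by linarith, by linarith⟩)
    rw [abs_le] at hst
    have a1 := foldCdf_mono K u (show s + δ ≤ t by linarith)
    have a2 : foldAvg K (fun j i => ramp δ s (u j i)) ≤ foldCdf K u (s + δ) :=
      foldAvg_mono fun j i _ => ramp_le_indicator hδ s _
    have a3 := (abs_le.1 (hDs s hs)).1
    have a4 := measureReal_Iic_le_integral_ramp (ν := ν) hδ s
    have a5 := hFmono (show t - 2 * δ ≤ s by linarith)
    dsimp only at a5
    linarith
  have h0 : 0 ≤ foldCdf K u t := foldCdf_nonneg u t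
  have h1 : foldCdf K u t ≤ 1 := foldCdf_le_one hK u t
  constructor
  · rcases le_or_gt M t with h | h
    · have := htailR (t + 2 * δ) (by linarith)
      linarith
    · rcases le_or_gt (-M - 3 * δ) t with h' | h'
      · have := core1 t h' (by linarith)
        linarith
      · have a1 := foldCdf_mono K u h'.le
        have a2 := core1 (-M - 3 * δ) le_rfl (by linarith)
        have a3 := htailL (-M - 3 * δ + 2 * δ) (by linarith)
        have : 0 ≤ ν.real (Set.Iic (t + 2 * δ)) := measureReal_nonneg
        linarith
  · rcases lt_or_ge (t - 2 * δ) (-M) with h | h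
    · have := htailL _ h
      linarith
    · rcases le_or_gt t (M + 3 * δ) with h' | h'
      · have := core2 t (by linarith) h'
        linarith
      · have a1 := foldCdf_mono K u h'.le
        have a2 := core2 (M + 3 * δ) (by linarith) le_rfl
        have a3 := htailR (M + 3 * δ - 2 * δ) (by linarith)
        have : ν.real (Set.Iic (t - 2 * δ)) ≤ 1 := measureReal_le_one
        linarith

/-- The probability integral transform, as an inequality valid without continuity. -/
lemma measureReal_cdf_between_le {a b : ℝ} (hab : a ≤ b) :
    ν.real {t | a ≤ ν.real (Set.Iio t) ∧ ν.real (Set.Iic t) ≤ b} ≤ b - a := by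
  have hm1 : Monotone fun t => ν.real (Set.Iio t) := fun s t hst =>
    measureReal_mono (Set.Iio_subset_Iio hst)
  have hm2 : Monotone fun t => ν.real (Set.Iic t) := fun s t hst =>
    measureReal_mono (Set.Iic_subset_Iic.2 hst)
  have hB : MeasurableSet {t | a ≤ ν.real (Set.Iio t) ∧ ν.real (Set.Iic t) ≤ b} :=
    (measurableSet_le measurable_const hm1.measurable).inter
      (measurableSet_le hm2.measurable measurable_const)
  refine ENNReal.toReal_le_of_le_ofReal (sub_nonneg.2 hab) ?_
  -- a compact subset lies between its minimum and its maximum, which both belong to the set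
  rw [hB.measure_eq_iSup_isCompact]
  refine iSup_le fun C => iSup_le fun hCB => iSup_le fun hC => ?_
  rcases C.eq_empty_or_nonempty with rfl | hne
  · simp
  have hs := hCB (hC.sInf_mem hne)
  have ht := hCB (hC.sSup_mem hne)
  rw [← ofReal_measureReal (measure_ne_top _ _)]
  refine ENNReal.ofReal_le_ofReal ?_
  have hsub : Set.Iio (sInf C) ∪ C ⊆ Set.Iic (sSup C) := by
    rintro x (hx | hx)
    · exact le_of_lt (lt_of_lt_of_le hx (Real.sInf_le_sSup C hC.bddBelow hC.bddAbove))
    · exact le_csSup hC.bddAbove hx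
  have hdisj : Disjoint (Set.Iio (sInf C)) C :=
    Set.disjoint_left.2 fun x hx hxC => (csInf_le hC.bddBelow hxC).not_gt hx
  have h1 := measureReal_mono (μ := ν) hsub
  rw [measureReal_union hdisj hC.measurableSet] at h1
  linarith [hs.1, ht.2]

variable {Ω : Type*} [MeasurableSpace Ω] {P : Measure Ω} [IsProbabilityMeasure P]

lemma le_measureReal_of_cdf_close {e : Ω → ℝ} (he : Measurable e) {F G : ℝ → ℝ} {ψ : ℝ}
    (hF : ∀ y, (P.map e).real (Set.Iic y) ≤ F y + ψ)
    (hG : ∀ y, G y ≤ (P.map e).real (Set.Iio y) + ψ) {a b : ℝ} (ha : 0 ≤ a) (hb : b ≤ 1)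
    (hψ : 0 ≤ ψ) : b - a - 2 * ψ ≤ P.real {z | a ≤ F (e z) ∧ G (e z) < b} := by
  have : IsProbabilityMeasure (P.map e) := Measure.isProbabilityMeasure_map he.aemeasurable
  have h1 := measureReal_cdf_between_le (ν := P.map e) (show 0 ≤ a + ψ by linarith)
  have h2 := measureReal_cdf_between_le (ν := P.map e) (show b - ψ ≤ 1 by linarith)
  have hle (B : Set ℝ) : P.real (e ⁻¹' B) ≤ (P.map e).real B :=
    ENNReal.toReal_mono (measure_ne_top _ _) (Measure.le_map_apply he.aemeasurable B)
  have h3 := (hle _).trans h1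
  have h4 := (hle _).trans h2
  have h5 : P.real Set.univ ≤ P.real {z | a ≤ F (e z) ∧ G (e z) < b} + _ :=
    (measureReal_mono (s₂ := _ ∪ (e ⁻¹' {t | 0 ≤ (P.map e).real (Set.Iio t) ∧
      (P.map e).real (Set.Iic t) ≤ a + ψ} ∪ e ⁻¹' {t | b - ψ ≤ (P.map e).real (Set.Iio t) ∧
      (P.map e).real (Set.Iic t) ≤ 1})) fun z _ => ?_).trans ((measureReal_union_le _ _).trans
      (add_le_add_right ((measureReal_union_le _ _).trans (add_le_add h3 h4)) _))
  · rw [probReal_univ] at h5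
    linarith
  · by_cases hza : a ≤ F (e z)
    · by_cases hzb : G (e z) < b
      · exact Or.inl ⟨hza, hzb⟩
      · refine Or.inr (Or.inr ⟨?_, measureReal_le_one⟩)
        linarith [hG (e z)]
    · refine Or.inr (Or.inl ⟨measureReal_nonneg, ?_⟩)
      linarith [hF (e z)]

lemma measureReal_le_of_cdf_close {e : Ω → ℝ} (he : Measurable e) {F G : ℝ → ℝ} {ψ : ℝ}
    (hF : ∀ y, F y ≤ (P.map e).real (Set.Iio y) + ψ)
    (hG : ∀ y, (P.map e).real (Set.Iic y) ≤ G y + ψ) {a b : ℝ} (hab : a ≤ b)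
    (hψ : 0 ≤ ψ) : P.real {z | a ≤ F (e z) ∧ G (e z) < b} ≤ b - a + 2 * ψ := by
  have : IsProbabilityMeasure (P.map e) := Measure.isProbabilityMeasure_map he.aemeasurable
  have h1 := measureReal_cdf_between_le (ν := P.map e) (show a - ψ ≤ b + ψ by linarith)
  have hle (B : Set ℝ) : P.real (e ⁻¹' B) ≤ (P.map e).real B :=
    ENNReal.toReal_mono (measure_ne_top _ _) (Measure.le_map_apply he.aemeasurable B)
  have h3 : P.real {z | a ≤ F (e z) ∧ G (e z) < b} ≤ _ :=
    (measureReal_mono fun z hz => ?_).trans ((hle _).trans h1)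
  · linarith
  · exact ⟨by linarith [hF (e z), hz.1], by linarith [hG (e z), hz.2]⟩

end Levy

/-! ### The values behind CV and CV+ -/

section Scores

variable {p n k : ℕ} {P : Measure (Obs p)} {A : Algorithm} {K : Fin k → Finset (Fin n)}

/-- The values `ŷ_{n+1} + û_i` of CV. -/
noncomputable def cvScore (A : Algorithm) (K : Fin k → Finset (Fin n)) (T : Fin n → Obs p)
    (x : Fin p → ℝ) (j : Fin k) (i : Fin n) : ℝ :=
  predict A T x + cvError A T (K j) i

/-- The values of CV+, which use the prediction without the fold of `i`. -/
noncomputable def cvPlusScore (A : Algorithm) (K : Fin k → Finset (Fin n)) (T : Fin n → Obs p)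
    (x : Fin p → ℝ) (j : Fin k) (i : Fin n) : ℝ :=
  predictWithout A T (K j) x + cvError A T (K j) i

/-- The change of the prediction at `x` when the fold `j` is left out. -/
noncomputable def instability (A : Algorithm) (K : Fin k → Finset (Fin n)) (T : Fin n → Obs p)
    (x : Fin p → ℝ) (j : Fin k) : ℝ :=
  |predict A T x - predictWithout A T (K j) x|

lemma abs_cvScore_sub_cvPlusScore_le (T : Fin n → Obs p) (x : Fin p → ℝ) (j : Fin k) (i : Fin n) :
    |cvScore A K T x j i - cvPlusScore A K T x j i| ≤ instability A K T x j := by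
  simp [cvScore, cvPlusScore, instability]

lemma measurable_predict (hA : ∀ q m, Measurable (A q m)) :
    Measurable fun q : (Fin n → Obs p) × (Fin p → ℝ) => predict A q.1 q.2 :=
  (hA p n).comp (measurable_snd.prodMk measurable_fst)

lemma measurable_predictWithout (hA : ∀ q m, Measurable (A q m)) (s : Finset (Fin n)) :
    Measurable fun q : (Fin n → Obs p) × (Fin p → ℝ) => predictWithout A q.1 s q.2 := by
  refine (hA p _).comp (measurable_snd.prodMk (measurable_pi_lambda _ fun i => ?_))
  exact (measurable_pi_apply _).comp measurable_fst

lemma measurable_cvError (hA : ∀ q m, Measurable (A q m)) (s : Finset (Fin n)) (i : Fin n) :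
    Measurable fun T : Fin n → Obs p => cvError A T s i := by
  have h : Measurable fun T : Fin n → Obs p => T i := measurable_pi_apply i
  exact (measurable_fst.comp h).sub
    ((measurable_predictWithout hA s).comp (measurable_id.prodMk (measurable_snd.comp h)))

lemma measurableScore_cvScore (hA : ∀ q m, Measurable (A q m)) :
    MeasurableScore (cvScore (p := p) A K) := fun j i =>
  (measurable_predict hA).add ((measurable_cvError hA (K j) i).comp measurable_fst)

lemma measurableScore_cvPlusScore (hA : ∀ q m, Measurable (A q m)) :
    MeasurableScore (cvPlusScore (p := p) A K) := fun j i =>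
  (measurable_predictWithout hA (K j)).add ((measurable_cvError hA (K j) i).comp measurable_fst)

lemma measurable_instability (hA : ∀ q m, Measurable (A q m)) (j : Fin k) :
    Measurable fun q : (Fin n → Obs p) × (Fin p → ℝ) => instability A K q.1 q.2 j :=
  ((measurable_predict hA).sub (measurable_predictWithout hA (K j))).abs

lemma predictWithout_piecewise (s : Finset (Fin n)) (T T' : Fin n → Obs p) (x : Fin p → ℝ) :
    predictWithout A (s.piecewise T' T) s x = predictWithout A T s x := by
  have : leaveOut (s.piecewise T' T) s = leaveOut T s := by
    funext i
    have h := sᶜ.orderEmbOfFin_mem rfl i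
    rw [Finset.mem_compl] at h
    simp only [leaveOut, Finset.piecewise_eq_of_notMem _ _ _ h]
  simp only [predictWithout, this]

/-- A bound for the Lévy distance between the fold-weighted distribution of the leave-one-fold-out
errors and the law of the prediction error, for fixed training data. -/
noncomputable def levyBound (P : Measure (Obs p)) (A : Algorithm) (K : Fin k → Finset (Fin n))
    (S : Finset ℝ) (δ M : ℝ) (T : Fin n → Obs p) : ℝ :=
  ∑ s ∈ S, |foldAvg K (fun j i => ramp δ s (cvError A T (K j) i)) -
      ∫ z, ramp δ s (z.1 - predict A T z.2) ∂P| +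
    P.real {z | M < |z.1 - predict A T z.2|}

lemma levyBound_nonneg (S : Finset ℝ) (δ M : ℝ) (T : Fin n → Obs p) :
    0 ≤ levyBound P A K S δ M T :=
  add_nonneg (Finset.sum_nonneg fun _ _ => abs_nonneg _) measureReal_nonneg

lemma coverage_cvScore (δ : ℝ) (α : ℝ × ℝ) (T : Fin n → Obs p) :
    coverage P K (cvScore A K) δ α T = P.real {z |
      α.1 ≤ foldCdf K (fun j i => cvError A T (K j) i) (z.1 - predict A T z.2 + δ) ∧
      foldCdfLT K (fun j i => cvError A T (K j) i) (z.1 - predict A T z.2 - δ) < α.2} := by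
  simp only [coverage, mem_distortedInterval_iff]
  congr 1
  ext z
  have h1 := foldCdf_const_add (K := K) (fun j i => cvError A T (K j) i) (predict A T z.2)
    (z.1 + δ)
  have h2 := foldCdfLT_const_add (K := K) (fun j i => cvError A T (K j) i) (predict A T z.2)
    (z.1 - δ)
  simp only [Set.mem_ofPred_eq, sub_add_eq_add_sub, sub_right_comm _ _ δ]
  rw [← h1, ← h2]
  rfl

variable [IsProbabilityMeasure P]

/-- The mean absolute error in estimating the conditional expectation of a Lipschitz function of the
prediction error by its cross-validation average. -/
lemma integral_abs_cvAvg_sub_le (hA : ∀ q m, Measurable (A q m)) (hK : IsFoldPartition K)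
    (hk : 0 < k) {h : ℝ → ℝ} (hm : Measurable h) (hb : ∀ u, h u ∈ Set.Icc (0 : ℝ) 1) {L : ℝ}
    (hL : ∀ u v, |h u - h v| ≤ L * |u - v|) (hL0 : 0 ≤ L) {η c r : ℝ} (hη : 0 ≤ η) (hc : 0 < c)
    (hr : L * η + (1 / (k : ℝ)) * ∑ j, ((Measure.pi fun _ => P).prod P).real
        {q : (Fin n → Obs p) × Obs p | η ≤ instability A K q.1 q.2.2 j} ≤ r) :
    ∫ T, |foldAvg K (fun j i => h (cvError A T (K j) i)) -
      ∫ z, h (z.1 - predict A T z.2) ∂P| ∂(Measure.pi fun _ => P) ≤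
      c + (1 / (k : ℝ) + 8 * r) / c + r := by
  set ρ := (Measure.pi fun _ : Fin n => P).prod P with hρ
  have hpair : Measurable fun q : (Fin n → Obs p) × Obs p => (q.1, q.2.2) := by fun_prop
  have hfst : Measurable fun q : (Fin n → Obs p) × Obs p => q.2.1 := by fun_prop
  have hf (j) : Measurable (Function.uncurry fun (T : Fin n → Obs p) (z : Obs p) =>
      h (z.1 - predictWithout A T (K j) z.2)) :=
    hm.comp (hfst.sub ((measurable_predictWithout hA (K j)).comp hpair))
  have hf₀ : Measurable (Function.uncurry fun (T : Fin n → Obs p) (z : Obs p) =>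
      h (z.1 - predict A T z.2)) :=
    hm.comp (hfst.sub ((measurable_predict hA).comp hpair))
  refine integral_abs_foldAvg_sub_le (P := P) hK hk hf hf₀ (fun j T z => hb _) (fun T z => hb _)
    (fun j T T' => by funext z; simp only [predictWithout_piecewise]) hc (le_trans ?_ hr)
  have hset (j) : MeasurableSet {q : (Fin n → Obs p) × Obs p | η ≤ instability A K q.1 q.2.2 j} :=
    measurableSet_le measurable_const ((measurable_instability hA j).comp hpair)
  have hj (j) : ∫ q, |h (q.2.1 - predictWithout A q.1 (K j) q.2.2) -
      h (q.2.1 - predict A q.1 q.2.2)| ∂ρ ≤ L * η +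
        ρ.real {q : (Fin n → Obs p) × Obs p | η ≤ instability A K q.1 q.2.2 j} := by
    have hint : Integrable ({q : (Fin n → Obs p) × Obs p |
        η ≤ instability A K q.1 q.2.2 j}.indicator (1 : (Fin n → Obs p) × Obs p → ℝ)) ρ :=
      (integrable_const (1 : ℝ)).indicator (hset j)
    have hI := integral_mono_of_nonneg (μ := ρ) (ae_of_all _ fun q => abs_nonneg
      (h (q.2.1 - predictWithout A q.1 (K j) q.2.2) - h (q.2.1 - predict A q.1 q.2.2)))
      ((integrable_const (L * η)).add hint) (ae_of_all _ fun q => ?_)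
    · simp only [Pi.add_apply] at hI
      rw [integral_add (integrable_const _) hint, integral_indicator_one (hset j)] at hI
      simpa using hI
    · have h1 := hb (q.2.1 - predictWithout A q.1 (K j) q.2.2)
      have h2 := hb (q.2.1 - predict A q.1 q.2.2)
      have hLη : 0 ≤ L * η := mul_nonneg hL0 hη
      simp only [Pi.add_apply, Set.indicator_apply, Set.mem_ofPred_eq, Pi.one_apply]
      split_ifs with hq
      · rw [abs_le]
        constructor <;> linarith [h1.1, h1.2, h2.1, h2.2]
      · refine (hL _ _).trans ?_
        rw [sub_sub_sub_cancel_left, add_zero]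
        exact mul_le_mul_of_nonneg_left (not_le.1 hq).le hL0
  have hk' : (k : ℝ) ≠ 0 := by exact_mod_cast hk.ne'
  calc (1 / (k : ℝ)) * ∑ j, ∫ q, |h (q.2.1 - predictWithout A q.1 (K j) q.2.2) -
      h (q.2.1 - predict A q.1 q.2.2)| ∂ρ
      ≤ (1 / (k : ℝ)) * ∑ j, (L * η +
        ρ.real {q : (Fin n → Obs p) × Obs p | η ≤ instability A K q.1 q.2.2 j}) := by
        gcongr with j _
        exact hj j
    _ = _ := by
        rw [Finset.sum_add_distrib, mul_add]
        simp
        field_simp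

/-! ### Coverage of CV for fixed training data -/

lemma measurable_sub_predict (hA : ∀ q m, Measurable (A q m)) (T : Fin n → Obs p) :
    Measurable fun z : Obs p => z.1 - predict A T z.2 :=
  measurable_fst.sub ((measurable_predict hA).comp (measurable_const.prodMk measurable_snd))

lemma levy_of_levyBound (hA : ∀ q m, Measurable (A q m)) (hK : IsFoldPartition K) {δ M : ℝ}
    (hδ : 0 < δ) (hM : 0 ≤ M) {S : Finset ℝ}
    (hS : ∀ r, |r| ≤ M + 5 * δ → ∃ s ∈ S, |s - r| ≤ δ / 2) (T : Fin n → Obs p) (t : ℝ) :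
    foldCdf K (fun j i => cvError A T (K j) i) t ≤
        (P.map fun z => z.1 - predict A T z.2).real (Set.Iic (t + 2 * δ)) +
          levyBound P A K S δ M T ∧
      (P.map fun z => z.1 - predict A T z.2).real (Set.Iic (t - 2 * δ)) ≤
        foldCdf K (fun j i => cvError A T (K j) i) t + levyBound P A K S δ M T := by
  have he := measurable_sub_predict hA T
  have : IsProbabilityMeasure (P.map fun z => z.1 - predict A T z.2) :=
    Measure.isProbabilityMeasure_map he.aemeasurable
  refine levy_of_ramps hK hδ hM hS _ (le_of_eq ?_) t
  rw [levyBound]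
  congr 1
  · refine Finset.sum_congr rfl fun s _ => ?_
    rw [integral_map he.aemeasurable (measurable_ramp δ s).aestronglyMeasurable]
  · rw [map_measureReal_apply he
      (measurableSet_lt measurable_const (by fun_prop) : MeasurableSet {x : ℝ | M < |x|})]
    rfl

lemma le_coverage_cvScore (hA : ∀ q m, Measurable (A q m)) (hK : IsFoldPartition K) {δ M : ℝ}
    (hδ : 0 < δ) (hM : 0 ≤ M) {S : Finset ℝ}
    (hS : ∀ r, |r| ≤ M + 5 * (δ / 4) → ∃ s ∈ S, |s - r| ≤ δ / 4 / 2) (T : Fin n → Obs p)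
    {α : ℝ × ℝ} (hα : α ∈ levels) :
    α.2 - α.1 - 2 * levyBound P A K S (δ / 4) M T ≤ coverage P K (cvScore A K) δ α T := by
  have he := measurable_sub_predict hA T
  have : IsProbabilityMeasure (P.map fun z => z.1 - predict A T z.2) :=
    Measure.isProbabilityMeasure_map he.aemeasurable
  have hlevy := levy_of_levyBound (P := P) hA hK (by positivity : 0 < δ / 4) hM hS T
  rw [coverage_cvScore]
  refine le_measureReal_of_cdf_close he (P := P)
    (F := fun y => foldCdf K (fun j i => cvError A T (K j) i) (y + δ))
    (G := fun y => foldCdfLT K (fun j i => cvError A T (K j) i) (y - δ))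
    (fun y => ?_) (fun y => ?_) hα.1 hα.2.2 (levyBound_nonneg _ _ _ _)
  · refine le_trans (measureReal_mono (Set.Iic_subset_Iic.2 ?_)) (hlevy (y + δ)).2
    linarith
  · refine (foldCdfLT_le_foldCdf _ _).trans ((hlevy (y - δ)).1.trans ?_)
    have hsub : Set.Iic (y - δ + 2 * (δ / 4)) ⊆ Set.Iio y := fun x hx =>
      Set.mem_Iio.2 ((Set.mem_Iic.1 hx).trans_lt (by linarith))
    exact add_le_add_left (measureReal_mono hsub) _

lemma coverage_cvScore_le (hA : ∀ q m, Measurable (A q m)) (hK : IsFoldPartition K) {δ M : ℝ}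
    (hδ : 0 < δ) (hM : 0 ≤ M) {S : Finset ℝ}
    (hS : ∀ r, |r| ≤ M + 5 * (δ / 4) → ∃ s ∈ S, |s - r| ≤ δ / 4 / 2) (T : Fin n → Obs p)
    {α : ℝ × ℝ} (hα : α ∈ levels) :
    coverage P K (cvScore A K) (-δ) α T ≤ α.2 - α.1 + 2 * levyBound P A K S (δ / 4) M T := by
  have he := measurable_sub_predict hA T
  have : IsProbabilityMeasure (P.map fun z => z.1 - predict A T z.2) :=
    Measure.isProbabilityMeasure_map he.aemeasurable
  have hlevy := levy_of_levyBound (P := P) hA hK (by positivity : 0 < δ / 4) hM hS T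
  rw [coverage_cvScore]
  refine measureReal_le_of_cdf_close he (P := P)
    (F := fun y => foldCdf K (fun j i => cvError A T (K j) i) (y + -δ))
    (G := fun y => foldCdfLT K (fun j i => cvError A T (K j) i) (y - -δ))
    (fun y => ?_) (fun y => ?_) hα.2.1 (levyBound_nonneg _ _ _ _)
  · refine (hlevy (y + -δ)).1.trans ?_
    have hsub : Set.Iic (y + -δ + 2 * (δ / 4)) ⊆ Set.Iio y := fun x hx =>
      Set.mem_Iio.2 ((Set.mem_Iic.1 hx).trans_lt (by linarith))
    exact add_le_add_left (measureReal_mono hsub) _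
  · have h1 := (hlevy (y + 2 * (δ / 4))).2
    rw [add_sub_cancel_right] at h1
    refine h1.trans ?_
    gcongr
    exact foldCdf_le_foldCdfLT_of_lt _ (by linarith)

lemma maxCoverageError_cvScore_le (hA : ∀ q m, Measurable (A q m)) (hK : IsFoldPartition K)
    {δ M w : ℝ} (hδ : 0 < δ) (hM : 0 ≤ M) {S : Finset ℝ}
    (hS : ∀ r, |r| ≤ M + 5 * (δ / 4) → ∃ s ∈ S, |s - r| ≤ δ / 4 / 2)
    (hP : ThinSetsSmall P δ w) (T : Fin n → Obs p) :
    maxCoverageError P K (cvScore A K) 0 T ≤ 2 * levyBound P A K S (δ / 4) M T + 2 * w := by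
  refine ciSup_le fun ⟨α, hα⟩ => ?_
  have h1 := le_coverage_cvScore (P := P) hA hK hδ hM hS T hα
  have h2 := coverage_cvScore_le (P := P) hA hK hδ hM hS T hα
  have hV : MeasurableScore (cvScore (p := p) A K) := measurableScore_cvScore hA
  have h3 := coverage_le_coverage_add_thin (K := K) hV hP T α (δ := 0) (δ' := δ) (by linarith)
  have h4 := coverage_le_coverage_add_thin (K := K) hV hP T α (δ := -δ) (δ' := 0) (by linarith)
  rw [abs_le]
  constructor <;> dsimp only <;> linarith

lemma measurable_cvAvg_sub (hA : ∀ q m, Measurable (A q m)) {h : ℝ → ℝ} (hm : Measurable h) :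
    Measurable fun T : Fin n → Obs p => |foldAvg K (fun j i => h (cvError A T (K j) i)) -
      ∫ z, h (z.1 - predict A T z.2) ∂P| := by
  refine (Measurable.sub (measurable_foldAvg fun j i => hm.comp (measurable_cvError hA (K j) i))
    ?_).abs
  have hpair : Measurable fun q : (Fin n → Obs p) × Obs p => (q.1, q.2.2) := by fun_prop
  have hfst : Measurable fun q : (Fin n → Obs p) × Obs p => q.2.1 := by fun_prop
  have : Measurable fun q : (Fin n → Obs p) × Obs p => h (q.2.1 - predict A q.1 q.2.2) :=
    hm.comp (hfst.sub ((measurable_predict hA).comp hpair))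
  exact (this.stronglyMeasurable.integral_prod_right' (ν := P)).measurable

lemma measurableSet_lt_abs_sub_predict (hA : ∀ q m, Measurable (A q m)) (M : ℝ) :
    MeasurableSet {q : (Fin n → Obs p) × Obs p | M < |q.2.1 - predict A q.1 q.2.2|} := by
  have hpair : Measurable fun q : (Fin n → Obs p) × Obs p => (q.1, q.2.2) := by fun_prop
  have hfst : Measurable fun q : (Fin n → Obs p) × Obs p => q.2.1 := by fun_prop
  exact measurableSet_lt measurable_const (hfst.sub ((measurable_predict hA).comp hpair)).abs

lemma measurable_levyBound (hA : ∀ q m, Measurable (A q m)) (S : Finset ℝ) (δ M : ℝ) :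
    Measurable (levyBound (n := n) (p := p) P A K S δ M) :=
  (Finset.measurable_fun_sum _ fun s _ => measurable_cvAvg_sub hA (measurable_ramp δ s)).add
    (measurable_measureReal_section (measurableSet_lt_abs_sub_predict hA M))

lemma abs_cvAvg_sub_mem_Icc (hK : IsFoldPartition K) {h : ℝ → ℝ}
    (hb : ∀ u, h u ∈ Set.Icc (0 : ℝ) 1) (T : Fin n → Obs p) :
    |foldAvg K (fun j i => h (cvError A T (K j) i)) - ∫ z, h (z.1 - predict A T z.2) ∂P| ∈
      Set.Icc (0 : ℝ) 1 := by
  have h1 := foldAvg_nonneg (K := K) (g := fun j i => h (cvError A T (K j) i)) fun j i => (hb _).1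
  have h2 := foldAvg_le_one hK (g := fun j i => h (cvError A T (K j) i)) fun j i => (hb _).2
  have h3 := integral_mem_Icc (μ := P) fun z : Obs p => hb (z.1 - predict A T z.2)
  exact ⟨abs_nonneg _, abs_le.2 ⟨by linarith [h3.2], by linarith [h3.1]⟩⟩

lemma integrable_cvAvg_sub (hA : ∀ q m, Measurable (A q m)) (hK : IsFoldPartition K) {h : ℝ → ℝ}
    (hm : Measurable h) (hb : ∀ u, h u ∈ Set.Icc (0 : ℝ) 1) :
    Integrable (fun T : Fin n → Obs p => |foldAvg K (fun j i => h (cvError A T (K j) i)) -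
      ∫ z, h (z.1 - predict A T z.2) ∂P|) (Measure.pi fun _ => P) :=
  integrable_of_mem_Icc (measurable_cvAvg_sub hA hm) (abs_cvAvg_sub_mem_Icc hK hb)

lemma integrable_tail (hA : ∀ q m, Measurable (A q m)) (M : ℝ) :
    Integrable (fun T : Fin n → Obs p => P.real {z | M < |z.1 - predict A T z.2|})
      (Measure.pi fun _ => P) :=
  integrable_of_mem_Icc (a := 0) (b := 1)
    (measurable_measureReal_section (measurableSet_lt_abs_sub_predict hA M))
    fun _ => ⟨measureReal_nonneg, measureReal_le_one⟩

lemma integrable_levyBound (hA : ∀ q m, Measurable (A q m)) (hK : IsFoldPartition K)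
    (S : Finset ℝ) (δ M : ℝ) :
    Integrable (levyBound (n := n) (p := p) P A K S δ M) (Measure.pi fun _ => P) :=
  (integrable_finsetSum S fun s _ => integrable_cvAvg_sub hA hK (measurable_ramp δ s)
    (ramp_mem_Icc δ s)).add (integrable_tail hA M)

lemma integral_levyBound (hA : ∀ q m, Measurable (A q m)) (hK : IsFoldPartition K)
    (S : Finset ℝ) (δ M : ℝ) :
    ∫ T, levyBound (n := n) (p := p) P A K S δ M T ∂(Measure.pi fun _ => P) =
      ∑ s ∈ S, ∫ T, |foldAvg K (fun j i => ramp δ s (cvError A T (K j) i)) -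
        ∫ z, ramp δ s (z.1 - predict A T z.2) ∂P| ∂(Measure.pi fun _ => P) +
      ((Measure.pi fun _ => P).prod P).real
        {q : (Fin n → Obs p) × Obs p | M < |q.2.1 - predict A q.1 q.2.2|} := by
  have hi (s) := integrable_cvAvg_sub (P := P) hA hK (measurable_ramp δ s) (ramp_mem_Icc δ s)
  simp only [levyBound]
  rw [integral_add (integrable_finsetSum S fun s _ => hi s) (integrable_tail hA M),
    integral_finsetSum S fun s _ => hi s,
    ← integral_measureReal_section (measurableSet_lt_abs_sub_predict hA M)]
  rfl

end Scores

/-! ### Asymptotics -/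

section Asymptotic

variable {Ω : ℕ → Type*} [∀ n, MeasurableSpace (Ω n)] {μ : ∀ n, Measure (Ω n)}
  [∀ n, IsProbabilityMeasure (μ n)] {p : ℕ → ℕ} {P : ∀ n, Measure (Obs (p n))}
  [∀ n, IsProbabilityMeasure (P n)] {Z : ∀ n, Fin (n + 1) → Ω n → Obs (p n)}
  {k : ℕ → ℕ} {K : ∀ n, Fin (k n) → Finset (Fin n)}

/-- If the events `E n` have probability tending to one, then so do events `E' n` that contain
`E n` outside `{X > c}` for variables `X` of arbitrarily small mean. The events need not be
measurable: only subadditivity of the outer measure is used. -/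
lemma tendsto_measureReal_one (hZ : ∀ n, 2 ≤ n → IsIIDSample (μ n) (P n) (Z n))
    {E E' : ∀ n, Set (Ω n)} (hE : Tendsto (fun n => (μ n).real (E n)) atTop (𝓝 1)) {c : ℝ}
    (hc : 0 < c)
    (h : ∀ τ : ℝ, 0 < τ → ∀ᶠ n in atTop, ∃ X : (Fin n → Obs (p n)) → ℝ,
      Measurable X ∧ (∀ T, 0 ≤ X T) ∧ Integrable X (Measure.pi fun _ => P n) ∧
      ∫ T, X T ∂(Measure.pi fun _ => P n) ≤ τ ∧
      ∀ᵐ ω ∂(μ n), ω ∈ E n → X (trainingData (Z n) ω) ≤ c → ω ∈ E' n) :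
    Tendsto (fun n => (μ n).real (E' n)) atTop (𝓝 1) := by
  rw [Metric.tendsto_atTop'] at hE ⊢
  intro τ hτ
  obtain ⟨N, hN⟩ := hE (τ / 2) (by positivity)
  obtain ⟨N', hN'⟩ := eventually_atTop.1 (h (c * (τ / 4)) (by positivity))
  refine ⟨max N (max N' 2), fun n hn => ?_⟩
  have hn1 : N < n := (le_max_left _ _).trans_lt hn
  have hn2 : N' ≤ n := ((le_max_left _ _).trans (le_max_right _ _)).trans hn.le
  have hn3 : 2 ≤ n := ((le_max_right _ _).trans (le_max_right _ _)).trans hn.le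
  obtain ⟨X, hXm, hX0, hXi, hXτ, hXE⟩ := hN' n hn2
  have h1 := hN n hn1
  rw [Real.dist_eq, abs_lt] at h1 ⊢
  have hle : (μ n).real (E' n) ≤ 1 := measureReal_le_one
  have hmarkov := mul_meas_ge_le_integral_of_nonneg (ae_of_all _ hX0) hXi c
  have hbad : (μ n).real {ω | c ≤ X (trainingData (Z n) ω)} ≤ τ / 4 := by
    have h2 : (μ n).real {ω | c ≤ X (trainingData (Z n) ω)} =
        (Measure.pi fun _ => P n).real {T | c ≤ X T} := by
      rw [← (hZ n hn3).map_trainingData, map_measureReal_apply (hZ n hn3).measurable_trainingData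
        (measurableSet_le measurable_const hXm)]
      rfl
    rw [h2]
    exact le_of_mul_le_mul_left (hmarkov.trans hXτ) hc
  set N₀ := {ω | ¬ (ω ∈ E n → X (trainingData (Z n) ω) ≤ c → ω ∈ E' n)} with hN₀
  have hnull : (μ n).real N₀ = 0 := by
    rw [measureReal_def, show (μ n) N₀ = 0 from hXE, ENNReal.toReal_zero]
  have hsub : (μ n).real (E n) ≤
      (μ n).real (E' n) + ((μ n).real {ω | c ≤ X (trainingData (Z n) ω)} + (μ n).real N₀) := by
    refine (measureReal_mono fun ω hω => ?_).trans ((measureReal_union_le _ _).trans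
      (add_le_add_right (measureReal_union_le _ _) _))
    by_cases h3 : ω ∈ N₀
    · exact Or.inr (Or.inr h3)
    · have h3 : ω ∈ E n → X (trainingData (Z n) ω) ≤ c → ω ∈ E' n := not_not.1 h3
      rcases le_or_gt c (X (trainingData (Z n) ω)) with h4 | h4
      · exact Or.inr (Or.inl h4)
      · exact Or.inl (h3 hω h4.le)
  constructor <;> linarith

variable {V V' : ∀ n, (Fin n → Obs (p n)) → (Fin (p n) → ℝ) → Fin (k n) → Fin n → ℝ}
  {d : ∀ n, (Fin n → Obs (p n)) → (Fin (p n) → ℝ) → Fin (k n) → ℝ}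

/-- Uniformly conservative coverage carries over to nearby values, with larger intervals. -/
lemma IsUnifConservative.of_close (hZ : ∀ n, 2 ≤ n → IsIIDSample (μ n) (P n) (Z n))
    (hK : ∀ n, 2 ≤ n → IsFoldPartition (K n))
    (hd : ∀ n T x j, ∀ i ∈ K n j, |V n T x j i - V' n T x j i| ≤ d n T x j)
    (hdm : ∀ n j, Measurable fun q : (Fin n → Obs (p n)) × (Fin (p n) → ℝ) => d n q.1 q.2 j)
    {δ η : ℝ}
    (hU : ∀ ε : ℝ, 0 < ε → Tendsto (fun n =>
      ∫ T, unstableProb (P n) (d n) η ε T ∂(Measure.pi fun _ => P n)) atTop (𝓝 0))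
    (h : IsUnifConservative μ Z fun n α T x => distortedInterval (foldCdf (K n) (V n T x)) α δ) :
    IsUnifConservative μ Z
      fun n α T x => distortedInterval (foldCdf (K n) (V' n T x)) α (δ + η) := by
  intro ε hε
  refine tendsto_measureReal_one hZ (h (ε / 4) (by positivity)) (c := ε / 4) (by positivity)
    fun τ hτ => ?_
  filter_upwards [(hU (ε / 8) (by positivity)).eventually (ge_mem_nhds hτ),
    eventually_ge_atTop 2] with n hn hn2
  have hUm := measurable_unstableProb (P := P n) (hdm n) η (ε / 8)
  refine ⟨unstableProb (P n) (d n) η (ε / 8), hUm, fun T => measureReal_nonneg,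
    integrable_of_mem_Icc (a := 0) (b := 1) hUm fun T => ⟨measureReal_nonneg, measureReal_le_one⟩,
    hn, ?_⟩
  filter_upwards [(hZ n hn2).ae_condCoverage_eq] with ω hω hE hX
  simp only [hω] at hE ⊢
  have hbdd : BddBelow (Set.range fun α : levels => coverage (P n) (K n) (V n) δ α
      (trainingData (Z n) ω) - (α.1.2 - α.1.1)) :=
    ⟨-1, by rintro _ ⟨α, rfl⟩; exact (abs_le.1 (abs_coverage_sub_le_one δ _ α)).1⟩
  refine le_ciInf fun α => ?_
  have := neg_le_coverage_sub_of_close (P := P n) (hK n hn2) (hd n) (δ := δ) (η := η)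
    (ε := ε / 8) (r := ε / 4) (by positivity) (by positivity) (T := trainingData (Z n) ω)
    (fun α hα => hE.trans (ciInf_le hbdd ⟨α, hα⟩)) α.2
  refine le_trans ?_ this
  linarith

/-- Uniform validity in terms of the law of the training data. -/
lemma isUnifValid_iff (hZ : ∀ n, 2 ≤ n → IsIIDSample (μ n) (P n) (Z n))
    (hV : ∀ n, MeasurableScore (V n)) {δ : ℝ} :
    IsUnifValid μ Z (fun n α T x => distortedInterval (foldCdf (K n) (V n T x)) α δ) ↔
      Tendsto (fun n => ∫ T, maxCoverageError (P n) (K n) (V n) δ T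
        ∂(Measure.pi fun _ => P n)) atTop (𝓝 0) := by
  refine tendsto_congr' ?_
  filter_upwards [eventually_ge_atTop 2] with n hn
  have h1 := integral_map (μ := μ n) (hZ n hn).measurable_trainingData.aemeasurable
    ((hV n).measurable_maxCoverageError (P := P n) (K := K n) δ).aestronglyMeasurable
  rw [(hZ n hn).map_trainingData] at h1
  rw [h1]
  refine integral_congr_ae ?_
  filter_upwards [(hZ n hn).ae_condCoverage_eq] with ω hω
  simp only [hω]
  rfl

lemma integrable_maxCoverageError {p n k : ℕ} {P : Measure (Obs p)} [IsProbabilityMeasure P]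
    {K : Fin k → Finset (Fin n)} {V : (Fin n → Obs p) → (Fin p → ℝ) → Fin k → Fin n → ℝ}
    (hV : MeasurableScore V) (δ : ℝ) :
    Integrable (maxCoverageError P K V δ) (Measure.pi fun _ => P) :=
  integrable_of_mem_Icc (hV.measurable_maxCoverageError δ) fun T =>
    ⟨maxCoverageError_nonneg δ T, maxCoverageError_le_one δ T⟩

/-- The Continuous Case Assumption makes sets with thin sections uniformly improbable. -/
lemma ContinuousCase.exists_thinSetsSmall (h : ContinuousCase P) {ε : ℝ} (hε : 0 < ε) :
    ∃ η > 0, ∀ n, 2 ≤ n → ThinSetsSmall (P n) η ε := by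
  obtain ⟨L, hL⟩ := h.stoch_bounded (ε / 2) (by positivity)
  refine ⟨ε / (2 * (L + 1)), by positivity, fun n hn B hB hthin => ?_⟩
  refine (measureReal_le_of_sections_thin (h.bounded_density n hn) (hL n hn) hB (by positivity)
    hthin).trans ?_
  have : ε / (2 * ((L : ℝ) + 1)) * L ≤ ε / 2 := by
    rw [div_mul_eq_mul_div, div_le_div_iff₀ (by positivity) (by positivity)]
    nlinarith [L.2]
  linarith

lemma IsUnifValid.of_close (hZ : ∀ n, 2 ≤ n → IsIIDSample (μ n) (P n) (Z n))
    (hK : ∀ n, 2 ≤ n → IsFoldPartition (K n)) (hP : ContinuousCase P)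
    (hV : ∀ n, MeasurableScore (V n)) (hV' : ∀ n, MeasurableScore (V' n))
    (hd : ∀ n T x j, ∀ i ∈ K n j, |V n T x j i - V' n T x j i| ≤ d n T x j)
    (hdm : ∀ n j, Measurable fun q : (Fin n → Obs (p n)) × (Fin (p n) → ℝ) => d n q.1 q.2 j)
    (hU : ∀ η ε : ℝ, 0 < η → 0 < ε → Tendsto (fun n =>
      ∫ T, unstableProb (P n) (d n) η ε T ∂(Measure.pi fun _ => P n)) atTop (𝓝 0))
    (h : IsUnifValid μ Z fun n α T x => distortedInterval (foldCdf (K n) (V' n T x)) α 0) :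
    IsUnifValid μ Z fun n α T x => distortedInterval (foldCdf (K n) (V n T x)) α 0 := by
  rw [isUnifValid_iff hZ hV'] at h
  rw [isUnifValid_iff hZ hV]
  rw [Metric.tendsto_nhds]
  intro ε hε
  obtain ⟨η, hη, hthin⟩ := hP.exists_thinSetsSmall (show 0 < ε / 12 by positivity)
  filter_upwards [h.eventually (gt_mem_nhds (show 0 < ε / 8 by positivity)),
    (hU η (ε / 12) hη (by positivity)).eventually (gt_mem_nhds (show 0 < ε / 16 by positivity)),
    eventually_ge_atTop 2] with n h1 h2 hn
  have hUm := measurable_unstableProb (P := P n) (hdm n) η (ε / 12)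
  have hUi : Integrable (unstableProb (P n) (d n) η (ε / 12)) (Measure.pi fun _ => P n) :=
    integrable_of_mem_Icc (a := 0) (b := 1) hUm fun T => ⟨measureReal_nonneg, measureReal_le_one⟩
  have hVi' := integrable_maxCoverageError (P := P n) (K := K n) (hV' n) 0
  have hi1 : Integrable (fun T => 2 * maxCoverageError (P n) (K n) (V' n) 0 T +
      2 * unstableProb (P n) (d n) η (ε / 12) T) (Measure.pi fun _ => P n) :=
    (hVi'.const_mul 2).add (hUi.const_mul 2)
  have hI := integral_mono_of_nonneg (ae_of_all _ fun T => maxCoverageError_nonneg 0 T)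
    (hi1.add (integrable_const (2 * (ε / 12) + 3 * (ε / 12))))
    (ae_of_all _ fun T => maxCoverageError_le_of_close (P := P n) (hK n hn) (hd n) (hV n) (hV' n)
      hη.le (hthin n hn) (show 0 ≤ ε / 12 by positivity) T)
  simp only [Pi.add_apply] at hI
  rw [integral_add hi1 (integrable_const _),
    integral_add (hVi'.const_mul 2) (hUi.const_mul 2), integral_const_mul, integral_const_mul,
    integral_const, probReal_univ, one_smul] at hI
  have h0 : 0 ≤ ∫ T, maxCoverageError (P n) (K n) (V n) 0 T ∂(Measure.pi fun _ => P n) :=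
    integral_nonneg fun T => maxCoverageError_nonneg 0 T
  rw [Real.dist_eq, sub_zero, abs_of_nonneg h0]
  linarith

variable {A : Algorithm}

lemma IsStable.tendsto_prod (hA : ∀ q m, Measurable (A q m))
    (hZ : ∀ n, 2 ≤ n → IsIIDSample (μ n) (P n) (Z n)) (hs : IsStable μ Z A K) {η : ℝ}
    (hη : 0 < η) :
    Tendsto (fun n => (1 / (k n : ℝ)) * ∑ j, ((Measure.pi fun _ => P n).prod (P n)).real
      {q : (Fin n → Obs (p n)) × Obs (p n) | η ≤ instability A (K n) q.1 q.2.2 j})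
      atTop (𝓝 0) := by
  refine (tendsto_congr' ?_).1 (hs η hη)
  filter_upwards [eventually_ge_atTop 2] with n hn
  congr 1
  refine Finset.sum_congr rfl fun j _ => ?_
  have hset : MeasurableSet {q : (Fin n → Obs (p n)) × Obs (p n) |
      η ≤ instability A (K n) q.1 q.2.2 j} :=
    measurableSet_le measurable_const ((measurable_instability hA j).comp
      (f := fun q : (Fin n → Obs (p n)) × Obs (p n) => (q.1, q.2.2)) (by fun_prop))
  rw [← (hZ n hn).map_pair, map_measureReal_apply
    ((hZ n hn).measurable_trainingData.prodMk (hZ n hn).measurable_newObs) hset]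
  rfl

lemma IsStable.tendsto_integral_unstableProb (hA : ∀ q m, Measurable (A q m))
    (hZ : ∀ n, 2 ≤ n → IsIIDSample (μ n) (P n) (Z n)) (hs : IsStable μ Z A K) {η ε : ℝ}
    (hη : 0 < η) (hε : 0 < ε) :
    Tendsto (fun n => ∫ T, unstableProb (P n) (instability A (K n)) η ε T
      ∂(Measure.pi fun _ => P n)) atTop (𝓝 0) := by
  have h := (hs.tendsto_prod hA hZ hη).const_mul (1 / ε)
  rw [mul_zero] at h
  exact squeeze_zero (fun n => integral_nonneg fun T => measureReal_nonneg)
    (fun n => integral_unstableProb_le (fun j => measurable_instability hA j) η hε) h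

/-- For a Lipschitz function of the prediction error, the cross-validation average converges in
`L¹` to the conditional expectation. -/
lemma IsStable.tendsto_integral_abs_cvAvg_sub (hA : ∀ q m, Measurable (A q m))
    (hZ : ∀ n, 2 ≤ n → IsIIDSample (μ n) (P n) (Z n)) (hK : ∀ n, 2 ≤ n → IsFoldPartition (K n))
    (hs : IsStable μ Z A K) (hk : Tendsto k atTop atTop) {h : ℝ → ℝ} (hm : Measurable h)
    (hb : ∀ u, h u ∈ Set.Icc (0 : ℝ) 1) {L : ℝ} (hL : ∀ u v, |h u - h v| ≤ L * |u - v|)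
    (hL0 : 0 < L) :
    Tendsto (fun n => ∫ T, |foldAvg (K n) (fun j i => h (cvError A T (K n j) i)) -
      ∫ z, h (z.1 - predict A T z.2) ∂(P n)| ∂(Measure.pi fun _ => P n)) atTop (𝓝 0) := by
  rw [Metric.tendsto_nhds]
  intro ε hε
  have hk' : Tendsto (fun n => 1 / (k n : ℝ)) atTop (𝓝 0) :=
    tendsto_one_div_atTop_nhds_zero_nat.comp hk
  -- with `c = ε / 4`, the bound `c + (1 / k + 8 r) / c + r` is below `ε` for these `r` and `k`
  obtain ⟨r, hr0, hr1, hr2⟩ : ∃ r : ℝ, 0 < r ∧ r < ε / 4 ∧ 8 * r < ε / 4 * (ε / 8) := by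
    refine ⟨min (ε / 8) (ε ^ 2 / 512), by positivity, ?_, ?_⟩
    · exact (min_le_left _ _).trans_lt (by linarith)
    · have := min_le_right (ε / 8) (ε ^ 2 / 512)
      have : 0 < ε ^ 2 := by positivity
      nlinarith
  have hη : 0 < r / (2 * L) := by positivity
  filter_upwards [(hs.tendsto_prod hA hZ hη).eventually
      (gt_mem_nhds (show 0 < r / 2 by positivity)),
    hk'.eventually (gt_mem_nhds (show 0 < ε / 4 * (ε / 8) by positivity)),
    hk.eventually_gt_atTop 0, eventually_ge_atTop 2] with n h1 h2 h3 hn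
  have hI := integral_abs_cvAvg_sub_le (P := P n) hA (hK n hn) h3 hm hb hL hL0.le hη.le
    (c := ε / 4) (r := r) (by positivity) (by
      have : L * (r / (2 * L)) = r / 2 := by field_simp
      rw [this]
      linarith)
  have h4 : (1 / (k n : ℝ) + 8 * r) / (ε / 4) < ε / 4 := by
    rw [div_lt_iff₀ (by positivity)]
    linarith
  rw [Real.dist_eq, sub_zero, abs_of_nonneg (integral_nonneg fun T => abs_nonneg _)]
  linarith

/-- The Lévy distance between the distribution of the leave-one-fold-out errors and the conditional
law of the prediction error is eventually small in mean. -/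
lemma IsStable.exists_integral_levyBound_le (hA : ∀ q m, Measurable (A q m))
    (hZ : ∀ n, 2 ≤ n → IsIIDSample (μ n) (P n) (Z n)) (hK : ∀ n, 2 ≤ n → IsFoldPartition (K n))
    (hs : IsStable μ Z A K) (hk : Tendsto k atTop atTop) (he : HasBoundedPredictionError μ Z A)
    {δ τ : ℝ} (hδ : 0 < δ) (hτ : 0 < τ) :
    ∃ (M : ℝ) (S : Finset ℝ), 0 ≤ M ∧ (∀ r, |r| ≤ M + 5 * δ → ∃ s ∈ S, |s - r| ≤ δ / 2) ∧
      ∀ᶠ n in atTop,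
        ∫ T, levyBound (P n) A (K n) S δ M T ∂(Measure.pi fun _ => P n) ≤ τ := by
  obtain ⟨M, hM⟩ := he (τ / 2) (by positivity)
  obtain ⟨t, htfin, ht⟩ := Metric.totallyBounded_iff.1
    (isCompact_Icc (a := -((M : ℝ) + 5 * δ)) (b := M + 5 * δ)).totallyBounded (δ / 2)
    (by positivity)
  refine ⟨M, htfin.toFinset, M.2, fun r hr => ?_, ?_⟩
  · obtain ⟨s, hs, hrs⟩ := Set.mem_iUnion₂.1 (ht (Set.mem_Icc.2 (abs_le.1 hr)))
    refine ⟨s, htfin.mem_toFinset.2 hs, ?_⟩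
    rw [Metric.mem_ball, Real.dist_eq] at hrs
    rw [abs_sub_comm]
    exact hrs.le
  · have hsum : Tendsto (fun n => ∑ s ∈ htfin.toFinset,
        ∫ T, |foldAvg (K n) (fun j i => ramp δ s (cvError A T (K n j) i)) -
          ∫ z, ramp δ s (z.1 - predict A T z.2) ∂(P n)| ∂(Measure.pi fun _ => P n))
        atTop (𝓝 0) := by
      rw [← Finset.sum_const_zero (s := htfin.toFinset) (M := ℝ)]
      exact tendsto_finsetSum _ fun s _ => hs.tendsto_integral_abs_cvAvg_sub hA hZ hK hk
        (measurable_ramp δ s) (ramp_mem_Icc δ s) (abs_ramp_sub_le hδ s) (by positivity)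
    filter_upwards [hsum.eventually (gt_mem_nhds (show 0 < τ / 2 by positivity)),
      eventually_ge_atTop 2] with n h1 hn
    rw [integral_levyBound hA (hK n hn)]
    have h2 := hM n hn
    have h3 : ((Measure.pi fun _ => P n).prod (P n)).real
        {q : (Fin n → Obs (p n)) × Obs (p n) | (M : ℝ) < |q.2.1 - predict A q.1 q.2.2|} =
        (μ n).real {ω | (M : ℝ≥0∞) < ‖(newObs (Z n) ω).1 -
          predict A (trainingData (Z n) ω) (newObs (Z n) ω).2‖ₑ} := by
      rw [← (hZ n hn).map_pair, map_measureReal_apply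
        ((hZ n hn).measurable_trainingData.prodMk (hZ n hn).measurable_newObs)
        (measurableSet_lt_abs_sub_predict hA M)]
      congr 1
      ext ω
      simp only [Set.mem_preimage, Set.mem_ofPred_eq]
      rw [enorm_eq_nnnorm, ENNReal.coe_lt_coe, ← NNReal.coe_lt_coe, coe_nnnorm, Real.norm_eq_abs]
    rw [h3]
    linarith

lemma IsStable.isUnifConservative_cvInterval (hA : ∀ q m, Measurable (A q m))
    (hZ : ∀ n, 2 ≤ n → IsIIDSample (μ n) (P n) (Z n)) (hK : ∀ n, 2 ≤ n → IsFoldPartition (K n))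
    (hs : IsStable μ Z A K) (hk : Tendsto k atTop atTop) (he : HasBoundedPredictionError μ Z A)
    {δ : ℝ} (hδ : 0 < δ) : IsUnifConservative μ Z fun n => cvInterval A (K n) δ := by
  intro ε hε
  refine tendsto_measureReal_one hZ (E := fun _ => Set.univ) (by simp) (c := ε / 2)
    (by positivity) fun τ hτ => ?_
  obtain ⟨M, S, hM, hS, hev⟩ := hs.exists_integral_levyBound_le hA hZ hK hk he
    (show 0 < δ / 4 by positivity) hτ
  filter_upwards [hev, eventually_ge_atTop 2] with n h1 hn
  refine ⟨levyBound (P n) A (K n) S (δ / 4) M, measurable_levyBound hA S _ M,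
    levyBound_nonneg S _ M, integrable_levyBound hA (hK n hn) S _ M, h1, ?_⟩
  filter_upwards [(hZ n hn).ae_condCoverage_eq] with ω hω _ hX
  simp only [hω]
  refine le_ciInf fun α => ?_
  have : _ ≤ (P n).real {z | z.1 ∈ cvInterval A (K n) δ α (trainingData (Z n) ω) z.2} :=
    le_coverage_cvScore (P := P n) hA (hK n hn) hδ hM hS (trainingData (Z n) ω) α.2
  linarith

lemma IsStable.isUnifNotOvershooting_cvInterval (hA : ∀ q m, Measurable (A q m))
    (hZ : ∀ n, 2 ≤ n → IsIIDSample (μ n) (P n) (Z n)) (hK : ∀ n, 2 ≤ n → IsFoldPartition (K n))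
    (hs : IsStable μ Z A K) (hk : Tendsto k atTop atTop) (he : HasBoundedPredictionError μ Z A)
    {δ : ℝ} (hδ : 0 < δ) : IsUnifNotOvershooting μ Z fun n => cvInterval A (K n) (-δ) := by
  intro ε hε
  refine tendsto_measureReal_one hZ (E := fun _ => Set.univ) (by simp) (c := ε / 2)
    (by positivity) fun τ hτ => ?_
  obtain ⟨M, S, hM, hS, hev⟩ := hs.exists_integral_levyBound_le hA hZ hK hk he
    (show 0 < δ / 4 by positivity) hτ
  filter_upwards [hev, eventually_ge_atTop 2] with n h1 hn
  refine ⟨levyBound (P n) A (K n) S (δ / 4) M, measurable_levyBound hA S _ M,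
    levyBound_nonneg S _ M, integrable_levyBound hA (hK n hn) S _ M, h1, ?_⟩
  filter_upwards [(hZ n hn).ae_condCoverage_eq] with ω hω _ hX
  simp only [hω]
  refine ciSup_le fun α => ?_
  have : (P n).real {z | z.1 ∈ cvInterval A (K n) (-δ) α (trainingData (Z n) ω) z.2} ≤ _ :=
    coverage_cvScore_le (P := P n) hA (hK n hn) hδ hM hS (trainingData (Z n) ω) α.2
  linarith

lemma IsStable.isUnifValid_cvInterval (hA : ∀ q m, Measurable (A q m))
    (hZ : ∀ n, 2 ≤ n → IsIIDSample (μ n) (P n) (Z n)) (hK : ∀ n, 2 ≤ n → IsFoldPartition (K n))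
    (hs : IsStable μ Z A K) (hk : Tendsto k atTop atTop) (he : HasBoundedPredictionError μ Z A)
    (hP : ContinuousCase P) : IsUnifValid μ Z fun n => cvInterval A (K n) 0 := by
  refine (isUnifValid_iff (V := fun n => cvScore A (K n)) hZ
    fun n => measurableScore_cvScore hA).2 ?_
  rw [Metric.tendsto_nhds]
  intro ε hε
  obtain ⟨δ, hδ, hthin⟩ := hP.exists_thinSetsSmall (show 0 < ε / 8 by positivity)
  obtain ⟨M, S, hM, hS, hev⟩ := hs.exists_integral_levyBound_le hA hZ hK hk he
    (show 0 < δ / 4 by positivity) (show 0 < ε / 8 by positivity)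
  filter_upwards [hev, eventually_ge_atTop 2] with n h1 hn
  have hi := (integrable_levyBound (P := P n) hA (hK n hn) S (δ / 4) M).const_mul 2
  have hI := integral_mono_of_nonneg (ae_of_all _ fun T => maxCoverageError_nonneg 0 T)
    (hi.add (integrable_const (2 * (ε / 8))))
    (ae_of_all _ fun T => maxCoverageError_cvScore_le (P := P n) hA (hK n hn) hδ hM hS
      (hthin n hn) T)
  simp only [Pi.add_apply] at hI
  rw [integral_add hi (integrable_const _), integral_const_mul, integral_const, probReal_univ,
    one_smul] at hI
  have h0 : 0 ≤ ∫ T, maxCoverageError (P n) (K n) (cvScore A (K n)) 0 T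
      ∂(Measure.pi fun _ => P n) := integral_nonneg fun T => maxCoverageError_nonneg 0 T
  rw [Real.dist_eq, sub_zero, abs_of_nonneg h0]
  linarith

end Asymptotic

end CrossVal

theorem mainTheorem4
    -- for every `n` a probability space with `n` i.i.d. training pairs and one new pair
    {Ω : ℕ → Type*} [∀ n, MeasurableSpace (Ω n)]
    (μ : ∀ n, Measure (Ω n)) [∀ n, IsProbabilityMeasure (μ n)]
    (p : ℕ → ℕ) (P : ∀ n, Measure (CrossVal.Obs (p n))) [∀ n, IsProbabilityMeasure (P n)]
    (Z : ∀ n, Fin (n + 1) → Ω n → CrossVal.Obs (p n))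
    (hZ : ∀ n, 2 ≤ n → CrossVal.IsIIDSample (μ n) (P n) (Z n))
    -- the prediction algorithm
    (A : CrossVal.Algorithm) (hA : ∀ q m, Measurable (A q m))
    -- the sequence of partitions
    (k : ℕ → ℕ) (K : ∀ n, Fin (k n) → Finset (Fin n))
    (hk : ∀ n, 2 ≤ n → 2 ≤ k n) (hK : ∀ n, 2 ≤ n → CrossVal.IsFoldPartition (K n))
    (hstable : CrossVal.IsStable μ Z A K) :
    -- a) asymptotic equivalence of CV and CV+
    (((∀ δ : ℝ, 0 < δ →
          CrossVal.IsUnifConservative μ Z (fun n => CrossVal.cvInterval A (K n) δ)) ↔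
        (∀ δ : ℝ, 0 < δ →
          CrossVal.IsUnifConservative μ Z (fun n => CrossVal.cvPlusInterval A (K n) δ))) ∧
      (CrossVal.ContinuousCase P →
        (CrossVal.IsUnifValid μ Z (fun n => CrossVal.cvInterval A (K n) 0) ↔
          CrossVal.IsUnifValid μ Z (fun n => CrossVal.cvPlusInterval A (K n) 0)))) ∧
    -- b) asymptotic validity of CV
    (CrossVal.HasBoundedPredictionError μ Z A → Tendsto k atTop atTop →
      (∀ δ : ℝ, 0 < δ →
        CrossVal.IsUnifConservative μ Z (fun n => CrossVal.cvInterval A (K n) δ) ∧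
        CrossVal.IsUnifNotOvershooting μ Z (fun n => CrossVal.cvInterval A (K n) (-δ))) ∧
      (CrossVal.ContinuousCase P →
        CrossVal.IsUnifValid μ Z (fun n => CrossVal.cvInterval A (K n) 0))) := by
  have hd : ∀ n T x j, ∀ i ∈ K n j, |CrossVal.cvScore (p := p n) A (K n) T x j i -
      CrossVal.cvPlusScore A (K n) T x j i| ≤ CrossVal.instability A (K n) T x j :=
    fun n T x j i _ => CrossVal.abs_cvScore_sub_cvPlusScore_le T x j i
  have hd' : ∀ n T x j, ∀ i ∈ K n j, |CrossVal.cvPlusScore (p := p n) A (K n) T x j i -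
      CrossVal.cvScore A (K n) T x j i| ≤ CrossVal.instability A (K n) T x j :=
    fun n T x j i hi => by rw [abs_sub_comm]; exact hd n T x j i hi
  have hdm : ∀ n j, Measurable fun q : (Fin n → CrossVal.Obs (p n)) × (Fin (p n) → ℝ) =>
      CrossVal.instability A (K n) q.1 q.2 j := fun n j => CrossVal.measurable_instability hA j
  have hV : ∀ n, CrossVal.MeasurableScore (CrossVal.cvScore (p := p n) A (K n)) :=
    fun n => CrossVal.measurableScore_cvScore hA
  have hV' : ∀ n, CrossVal.MeasurableScore (CrossVal.cvPlusScore (p := p n) A (K n)) :=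
    fun n => CrossVal.measurableScore_cvPlusScore hA
  have hU : ∀ η ε : ℝ, 0 < η → 0 < ε → Tendsto (fun n =>
      ∫ T, CrossVal.unstableProb (P n) (CrossVal.instability A (K n)) η ε T
        ∂(Measure.pi fun _ => P n)) atTop (𝓝 0) :=
    fun η ε hη hε => hstable.tendsto_integral_unstableProb hA hZ hη hε
  refine ⟨⟨⟨fun h δ hδ => ?_, fun h δ hδ => ?_⟩, fun hP => ⟨fun h => ?_, fun h => ?_⟩⟩,
    fun he hkt => ⟨fun δ hδ => ⟨?_, ?_⟩, fun hP => ?_⟩⟩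
  · rw [← add_halves δ]
    exact CrossVal.IsUnifConservative.of_close hZ hK hd hdm
      (fun ε hε => hU (δ / 2) ε (half_pos hδ) hε) (h (δ / 2) (half_pos hδ))
  · rw [← add_halves δ]
    exact CrossVal.IsUnifConservative.of_close hZ hK hd' hdm
      (fun ε hε => hU (δ / 2) ε (half_pos hδ) hε) (h (δ / 2) (half_pos hδ))
  · exact CrossVal.IsUnifValid.of_close hZ hK hP hV' hV hd' hdm hU h
  · exact CrossVal.IsUnifValid.of_close hZ hK hP hV hV' hd hdm hU h
  · exact hstable.isUnifConservative_cvInterval hA hZ hK hkt he hδ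
  · exact hstable.isUnifNotOvershooting_cvInterval hA hZ hK hkt he hδ
  · exact hstable.isUnifValid_cvInterval hA hZ hK hkt he hP
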